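/- Let $\Bbbk$ be a field of characteristic $0$. Consider symmetric coloured operads in $\Bbbk$-vector spaces on two colours $\mathsf{f}$ ("functions") and $\mathsf{v}$ ("derivations"), without operations of arity $0$; $\mathcal P(A,c)$ denotes the space of operations whose inputs form the non-empty finite coloured set $A$ and whose output has colour $c$. Let $\mathsf{DCom}$ be the operad generated by two binary operations $\alpha:\mathsf f\otimes\mathsf f\to\mathsf f$ and $d:\mathsf f\otimes\mathsf v\to\mathsf f$ subject to $$\alpha(1,2)=\alpha(2,1),\quad \alpha(\alpha(1,2),3)=\alpha(1,\alpha(2,3)),\quad d(\alpha(1,2),3)=\alpha(1,d(2,3))+\alpha(d(1,3),2).$$ (Its algebras are pairs of a commutative associative algebra and a vector space acting on it by derivations.) Let $\mathsf{LieR}$ be the operad of Lie–Rinehart algebras, generated by $\alpha:\mathsf f\otimes\mathsf f\to\mathsf f$, $\beta:\mathsf v\otimes\mathsf v\to\mathsf v$, $d:\mathsf f\otimes\mathsf v\to\mathsf f$ and $m:\mathsf f\otimes\mathsf v\to\mathsf v$, subject to the three relations above together with $$\beta(1,2)=-\beta(2,1),\quad \beta(\beta(1,2),3)-\beta(\beta(1,3),2)-\beta(1,\beta(2,3))=0,$$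 $$d(1,\beta(2,3))=d(d(1,3),2)-d(d(1,2),3),\quad m(\alpha(1,2),3)=m(1,m(2,3)),$$ $$d(1,m(2,3))=\alpha(d(1,3),2),\quad \beta(2,m(1,3))=m(1,\beta(2,3))+m(d(1,2),3).$$ Then there is exactly one morphism of coloured operads $\mathsf{DCom}\to\mathsf{LieR}$ that sends $\alpha$ to $\alpha$ and $d$ to $d$, and it is an embedding: $\mathsf{DCom}(A,c)\to\mathsf{LieR}(A,c)$ is injective for every non-empty finite coloured set $A$ and every colour $c$. -/

import Mathlib

universe u v w

namespace ColOp

/-! ### Coloured finite sets -/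

/-- A non-empty finite set coloured by `I`. -/
structure CSet (I : Type) where
  carrier : Type
  [fin : Finite carrier]
  [ne : Nonempty carrier]
  col : carrier → I

attribute [instance] CSet.fin CSet.ne

namespace CSet

variable {I : Type}

/-- The one-point set of colour `c`. -/
abbrev single (c : I) : CSet I := ⟨Unit, fun _ => c⟩

/-- The set `{0, …, n}` with the given colouring. -/
abbrev ofFin {n : ℕ} (χ : Fin (n + 1) → I) : CSet I := ⟨Fin (n + 1), χ⟩

/-- The inputs of a partial composition: the element `x` of `A` is replaced by all of `B`. -/
abbrev graft (A : CSet I) (x : A.carrier) (B : CSet I) : CSet I :=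
  ⟨{a : A.carrier // a ≠ x} ⊕ B.carrier, Sum.elim (fun a => A.col a.1) B.col⟩

theorem graft_col_inl (A : CSet I) (x : A.carrier) (B : CSet I) (a : {a : A.carrier // a ≠ x}) :
    (A.graft x B).col (Sum.inl a) = A.col a.1 := rfl

theorem graft_col_inr (A : CSet I) (x : A.carrier) (B : CSet I) (b : B.carrier) :
    (A.graft x B).col (Sum.inr b) = B.col b := rfl

/-- Colour-preserving bijections. -/
structure Iso (A B : CSet I) where
  equiv : A.carrier ≃ B.carrier
  col_eq : ∀ a, B.col (equiv a) = A.col a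

/-- The identity bijection. -/
def Iso.refl (A : CSet I) : Iso A A := ⟨Equiv.refl _, fun _ => rfl⟩

/-- The composite of two colour-preserving bijections. -/
def Iso.trans {A B C : CSet I} (e : Iso A B) (f : Iso B C) : Iso A C :=
  ⟨e.equiv.trans f.equiv, fun a => (f.col_eq _).trans (e.col_eq a)⟩

/-- Grafting is functorial for colour-preserving bijections. -/
def graftIso {A A' B B' : CSet I} (e : Iso A A') (x : A.carrier) (f : Iso B B') :
    Iso (A.graft x B) (A'.graft (e.equiv x) B') where
  equiv := Equiv.sumCongr
    (e.equiv.subtypeEquiv fun _ => (not_congr e.equiv.injective.eq_iff).symm) f.equiv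
  col_eq := by
    rintro (a | b)
    · exact e.col_eq a.1
    · exact f.col_eq b

/-- Grafting onto a single point. -/
def leftUnitIso (c : I) (B : CSet I) : Iso ((single c).graft () B) B where
  equiv :=
    { toFun := Sum.elim (fun a => absurd rfl a.2) id
      invFun := Sum.inr
      left_inv := by
        rintro (a | b)
        · exact absurd rfl a.2
        · rfl
      right_inv := fun _ => rfl }
  col_eq := by
    rintro (a | b)
    · exact absurd rfl a.2
    · rfl

open Classical in
/-- Grafting a single point. -/
noncomputable def rightUnitIso {c : I} (A : CSet I) (x : A.carrier) (h : A.col x = c) :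
    Iso (A.graft x (single c)) A where
  equiv :=
    { toFun := Sum.elim Subtype.val (fun _ => x)
      invFun := fun a => if ha : a = x then Sum.inr () else Sum.inl ⟨a, ha⟩
      left_inv := by
        rintro (a | b)
        · exact dif_neg a.2
        · exact dif_pos rfl
      right_inv := fun a => by
        by_cases ha : a = x
        · exact (congrArg (Sum.elim Subtype.val fun _ => x) (dif_pos ha)).trans ha.symm
        · exact congrArg (Sum.elim Subtype.val fun _ => x) (dif_neg ha) }
  col_eq := by
    rintro (a | b)
    · rfl
    · exact h

/-- `(A ∘ₓ B) ∘_y C ≅ A ∘ₓ (B ∘_y C)` for `x ∈ A` and `y ∈ B`. -/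
def seqIso (A B C : CSet I) (x : A.carrier) (y : B.carrier) :
    Iso ((A.graft x B).graft (Sum.inr y) C) (A.graft x (B.graft y C)) where
  equiv :=
    { toFun := fun p => match p with
        | Sum.inl ⟨Sum.inl a, _⟩ => Sum.inl a
        | Sum.inl ⟨Sum.inr b, h⟩ => Sum.inr (Sum.inl ⟨b, fun hb => h (congrArg Sum.inr hb)⟩)
        | Sum.inr c => Sum.inr (Sum.inr c)
      invFun := fun p => match p with
        | Sum.inl a => Sum.inl ⟨Sum.inl a, Sum.inl_ne_inr⟩
        | Sum.inr (Sum.inl b) => Sum.inl ⟨Sum.inr b.1, fun h => b.2 (Sum.inr_injective h)⟩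
        | Sum.inr (Sum.inr c) => Sum.inr c
      left_inv := by rintro (⟨a | b, h⟩ | c) <;> rfl
      right_inv := by rintro (a | b | c) <;> rfl }
  col_eq := by rintro (⟨a | b, h⟩ | c) <;> rfl

/-- `(A ∘ₓ B) ∘_y C ≅ (A ∘_y C) ∘ₓ B` for distinct `x, y ∈ A`. -/
def parIso (A B C : CSet I) (x y : A.carrier) (hxy : x ≠ y) :
    Iso ((A.graft x B).graft (Sum.inl ⟨y, hxy.symm⟩) C)
      ((A.graft y C).graft (Sum.inl ⟨x, hxy⟩) B) where
  equiv :=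
    { toFun := fun p => match p with
        | Sum.inl ⟨Sum.inl a, h⟩ =>
            Sum.inl ⟨Sum.inl ⟨a.1, fun e => h (congrArg Sum.inl (Subtype.ext e))⟩,
              fun e => a.2 (congrArg Subtype.val (Sum.inl_injective e))⟩
        | Sum.inl ⟨Sum.inr b, _⟩ => Sum.inr b
        | Sum.inr c => Sum.inl ⟨Sum.inr c, Sum.inr_ne_inl⟩
      invFun := fun p => match p with
        | Sum.inl ⟨Sum.inl a, h⟩ =>
            Sum.inl ⟨Sum.inl ⟨a.1, fun e => h (congrArg Sum.inl (Subtype.ext e))⟩,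
              fun e => a.2 (congrArg Subtype.val (Sum.inl_injective e))⟩
        | Sum.inl ⟨Sum.inr c, _⟩ => Sum.inr c
        | Sum.inr b => Sum.inl ⟨Sum.inr b, Sum.inr_ne_inl⟩
      left_inv := by rintro (⟨a | b, h⟩ | c) <;> rfl
      right_inv := by rintro (⟨a | b, h⟩ | c) <;> rfl }
  col_eq := by rintro (⟨a | b, h⟩ | c) <;> rfl

end CSet

/-! ### Symmetric coloured operads -/

/-- A symmetric `I`-coloured operad in `𝕜`-modules, by partial compositions: `obj A c` is the module
of operations with inputs the coloured set `A` and output colour `c`. The values on the sets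
`{1, …, n}` carry the actions of the symmetric groups through `relabel`. -/
structure Operad (𝕜 : Type u) [Field 𝕜] (I : Type) where
  obj : CSet I → I → Type v
  [addCommGroup : ∀ A c, AddCommGroup (obj A c)]
  [module : ∀ A c, Module 𝕜 (obj A c)]
  relabel : ∀ {A B : CSet I} {c : I}, CSet.Iso A B → obj A c →ₗ[𝕜] obj B c
  one : ∀ c : I, obj (CSet.single c) c
  /-- The partial composition, defined when the output colour of the second operation is the colour
  of the input `x` of the first one. -/
  comp : ∀ {A B : CSet I} {c d : I} (x : A.carrier), A.col x = d →
    (obj A c →ₗ[𝕜] obj B d →ₗ[𝕜] obj (A.graft x B) c)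
  relabel_refl : ∀ {A : CSet I} {c : I} (μ : obj A c), relabel (CSet.Iso.refl A) μ = μ
  relabel_trans : ∀ {A B C : CSet I} {c : I} (e : CSet.Iso A B) (f : CSet.Iso B C) (μ : obj A c),
    relabel (e.trans f) μ = relabel f (relabel e μ)
  relabel_comp : ∀ {A A' B B' : CSet I} {c d : I} (e : CSet.Iso A A') (f : CSet.Iso B B')
    (x : A.carrier) (h : A.col x = d) (μ : obj A c) (ν : obj B d),
    relabel (CSet.graftIso e x f) (comp x h μ ν) =
      comp (e.equiv x) ((e.col_eq x).trans h) (relabel e μ) (relabel f ν)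
  one_comp : ∀ {B : CSet I} {c : I} (ν : obj B c),
    relabel (CSet.leftUnitIso c B) (comp (A := CSet.single c) () rfl (one c) ν) = ν
  comp_one : ∀ {A : CSet I} {c d : I} (x : A.carrier) (h : A.col x = d) (μ : obj A c),
    relabel (CSet.rightUnitIso A x h) (comp x h μ (one d)) = μ
  comp_seq : ∀ {A B C : CSet I} {c d d' : I} (x : A.carrier) (hx : A.col x = d)
    (y : B.carrier) (hy : B.col y = d') (l : obj A c) (μ : obj B d) (ν : obj C d'),
    relabel (CSet.seqIso A B C x y)
      (comp (Sum.inr y) ((CSet.graft_col_inr A x B y).trans hy) (comp x hx l μ) ν) = comp x hx l (comp y hy μ ν)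
  comp_par : ∀ {A B C : CSet I} {c d d' : I} (x y : A.carrier) (hxy : x ≠ y) (hx : A.col x = d)
    (hy : A.col y = d') (l : obj A c) (μ : obj B d) (ν : obj C d'),
    relabel (CSet.parIso A B C x y hxy)
      (comp (Sum.inl ⟨y, hxy.symm⟩) ((CSet.graft_col_inl A x B _).trans hy) (comp x hx l μ) ν) =
      comp (Sum.inl ⟨x, hxy⟩) ((CSet.graft_col_inl A y C _).trans hx) (comp y hy l ν) μ

attribute [instance] Operad.addCommGroup Operad.module

variable {𝕜 : Type u} [Field 𝕜] {I : Type}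

/-- Morphisms of coloured operads. -/
@[ext]
structure Operad.Hom (P : Operad.{u, v} 𝕜 I) (Q : Operad.{u, w} 𝕜 I) where
  app : ∀ (A : CSet I) (c : I), P.obj A c →ₗ[𝕜] Q.obj A c
  app_relabel : ∀ {A B : CSet I} {c : I} (e : CSet.Iso A B) (μ : P.obj A c),
    app B c (P.relabel e μ) = Q.relabel e (app A c μ)
  app_one : ∀ c : I, app _ c (P.one c) = Q.one c
  app_comp : ∀ {A B : CSet I} {c d : I} (x : A.carrier) (h : A.col x = d) (μ : P.obj A c)
    (ν : P.obj B d), app _ c (P.comp x h μ ν) = Q.comp x h (app A c μ) (app B d ν)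

/-- Membership in the operadic ideal generated by a family `R` of elements. -/
inductive Operad.InIdeal (P : Operad.{u, v} 𝕜 I) (R : ∀ (A : CSet I) (c : I), P.obj A c → Prop) :
    ∀ (A : CSet I) (c : I), P.obj A c → Prop
  | of {A c} (μ : P.obj A c) : R A c μ → InIdeal P R A c μ
  | zero {A c} : InIdeal P R A c 0
  | add {A c} (μ ν : P.obj A c) :
      InIdeal P R A c μ → InIdeal P R A c ν → InIdeal P R A c (μ + ν)
  | smul {A c} (r : 𝕜) (μ : P.obj A c) : InIdeal P R A c μ → InIdeal P R A c (r • μ)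
  | relabel {A B c} (e : CSet.Iso A B) (μ : P.obj A c) :
      InIdeal P R A c μ → InIdeal P R B c (P.relabel e μ)
  | comp_left {A B c d} (x : A.carrier) (h : A.col x = d) (μ : P.obj A c) (ν : P.obj B d) :
      InIdeal P R A c μ → InIdeal P R (A.graft x B) c (P.comp x h μ ν)
  | comp_right {A B c d} (x : A.carrier) (h : A.col x = d) (μ : P.obj A c) (ν : P.obj B d) :
      InIdeal P R B d ν → InIdeal P R (A.graft x B) c (P.comp x h μ ν)

/-- The components of the operadic ideal generated by `R`. -/
def Operad.ideal (P : Operad.{u, v} 𝕜 I) (R : ∀ (A : CSet I) (c : I), P.obj A c → Prop)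
    (A : CSet I) (c : I) : Submodule 𝕜 (P.obj A c) where
  carrier := {μ | P.InIdeal R A c μ}
  add_mem' h h' := .add _ _ h h'
  zero_mem' := .zero
  smul_mem' r _ h := .smul r _ h

section Quotient

variable (P : Operad.{u, v} 𝕜 I) (R : ∀ (A : CSet I) (c : I), P.obj A c → Prop)

/-- Relabelling on the quotient by an operadic ideal. -/
def Operad.quotRelabel {A B : CSet I} {c : I} (e : CSet.Iso A B) :
    (P.obj A c ⧸ P.ideal R A c) →ₗ[𝕜] (P.obj B c ⧸ P.ideal R B c) :=
  (P.ideal R A c).mapQ (P.ideal R B c) (P.relabel e) fun μ h => .relabel e μ h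

theorem Operad.quotRelabel_mk {A B : CSet I} {c : I} (e : CSet.Iso A B) (μ : P.obj A c) :
    P.quotRelabel R e ((P.ideal R A c).mkQ μ) = (P.ideal R B c).mkQ (P.relabel e μ) := rfl

/-- Partial composition on the quotient by an operadic ideal. -/
def Operad.quotComp {A B : CSet I} {c d : I} (x : A.carrier) (h : A.col x = d) :
    (P.obj A c ⧸ P.ideal R A c) →ₗ[𝕜] (P.obj B d ⧸ P.ideal R B d) →ₗ[𝕜]
      (P.obj (A.graft x B) c ⧸ P.ideal R (A.graft x B) c) :=
  (P.ideal R A c).liftQ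
    { toFun := fun μ => (P.ideal R B d).mapQ (P.ideal R (A.graft x B) c) (P.comp x h μ)
        fun ν hν => .comp_right x h μ ν hν
      map_add' := fun μ μ' => Submodule.linearMap_qext _ <| LinearMap.ext fun ν =>
        congrArg (P.ideal R (A.graft x B) c).mkQ
          (LinearMap.congr_fun ((P.comp x h).map_add μ μ') ν)
      map_smul' := fun r μ => Submodule.linearMap_qext _ <| LinearMap.ext fun ν =>
        congrArg (P.ideal R (A.graft x B) c).mkQ
          (LinearMap.congr_fun ((P.comp x h).map_smul r μ) ν) }
    fun μ hμ => Submodule.linearMap_qext _ <| LinearMap.ext fun ν =>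
      (Submodule.Quotient.mk_eq_zero _).2 (.comp_left x h μ ν hμ)

theorem Operad.quotComp_mk {A B : CSet I} {c d : I} (x : A.carrier) (h : A.col x = d)
    (μ : P.obj A c) (ν : P.obj B d) :
    P.quotComp R x h ((P.ideal R A c).mkQ μ) ((P.ideal R B d).mkQ ν) =
      (P.ideal R (A.graft x B) c).mkQ (P.comp x h μ ν) := rfl

/-- The quotient of a coloured operad by the operadic ideal generated by `R`. -/
def Operad.quotient : Operad.{u, v} 𝕜 I where
  obj A c := P.obj A c ⧸ P.ideal R A c
  relabel e := P.quotRelabel R e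
  one c := (P.ideal R _ c).mkQ (P.one c)
  comp x h := P.quotComp R x h
  relabel_refl μ := by
    obtain ⟨μ, rfl⟩ := Submodule.mkQ_surjective _ μ
    rw [quotRelabel_mk, P.relabel_refl]
  relabel_trans e f μ := by
    obtain ⟨μ, rfl⟩ := Submodule.mkQ_surjective _ μ
    rw [quotRelabel_mk, quotRelabel_mk, quotRelabel_mk, P.relabel_trans]
  relabel_comp e f x h μ ν := by
    obtain ⟨μ, rfl⟩ := Submodule.mkQ_surjective _ μ
    obtain ⟨ν, rfl⟩ := Submodule.mkQ_surjective _ ν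
    rw [quotRelabel_mk, quotRelabel_mk, quotComp_mk, quotComp_mk, quotRelabel_mk, P.relabel_comp]
  one_comp ν := by
    obtain ⟨ν, rfl⟩ := Submodule.mkQ_surjective _ ν
    rw [quotComp_mk, quotRelabel_mk, P.one_comp]
  comp_one x h μ := by
    obtain ⟨μ, rfl⟩ := Submodule.mkQ_surjective _ μ
    rw [quotComp_mk, quotRelabel_mk, P.comp_one]
  comp_seq x hx y hy l μ ν := by
    obtain ⟨l, rfl⟩ := Submodule.mkQ_surjective _ l
    obtain ⟨μ, rfl⟩ := Submodule.mkQ_surjective _ μ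
    obtain ⟨ν, rfl⟩ := Submodule.mkQ_surjective _ ν
    rw [quotComp_mk, quotComp_mk, quotComp_mk, quotComp_mk, quotRelabel_mk, P.comp_seq]
  comp_par x y hxy hx hy l μ ν := by
    obtain ⟨l, rfl⟩ := Submodule.mkQ_surjective _ l
    obtain ⟨μ, rfl⟩ := Submodule.mkQ_surjective _ μ
    obtain ⟨ν, rfl⟩ := Submodule.mkQ_surjective _ ν
    rw [quotComp_mk, quotComp_mk, quotComp_mk, quotComp_mk, quotRelabel_mk, P.comp_par]

end Quotient

/-! ### Free coloured operads on binary operations -/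

/-- A signature of binary operations with prescribed input and output colours. -/
structure Signature (I : Type) where
  Op : Type
  left : Op → I
  right : Op → I
  out : Op → I

/-- Planar binary rooted trees with vertices marked by `O` and leaves labelled by `X`. -/
inductive Tree (O : Type) (X : Type) : Type
  | leaf : X → Tree O X
  | node : O → Tree O X → Tree O X → Tree O X

namespace Tree

variable {O X Y Z : Type}

/-- The leaf labels, from left to right. -/
def leaves : Tree O X → List X
  | leaf x => [x]
  | node _ l r => l.leaves ++ r.leaves

/-- Substitution of trees for the leaves. -/
def bind : Tree O X → (X → Tree O Y) → Tree O Y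
  | leaf x, f => f x
  | node g l r, f => node g (l.bind f) (r.bind f)

/-- Relabelling of the leaves. -/
def map (f : X → Y) (t : Tree O X) : Tree O Y := t.bind fun x => leaf (f x)

theorem bind_bind (t : Tree O X) (f : X → Tree O Y) (g : Y → Tree O Z) :
    (t.bind f).bind g = t.bind fun x => (f x).bind g := by
  induction t with
  | leaf x => rfl
  | node o l r hl hr => simp only [bind, hl, hr]

theorem bind_leaf (t : Tree O X) : t.bind leaf = t := by
  induction t with
  | leaf x => rfl
  | node o l r hl hr => simp only [bind, hl, hr]

theorem leaves_bind (t : Tree O X) (f : X → Tree O Y) :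
    (t.bind f).leaves = t.leaves.flatMap fun x => (f x).leaves := by
  induction t with
  | leaf x => simp [bind, leaves]
  | node o l r hl hr => simp [bind, leaves, hl, hr]

open Classical in
/-- Grafting `s` onto the leaf `x` of `t`. -/
noncomputable def graft (t : Tree O X) (x : X) (s : Tree O Y) :
    Tree O ({a : X // a ≠ x} ⊕ Y) :=
  t.bind fun a => if h : a = x then s.map Sum.inr else leaf (Sum.inl ⟨a, h⟩)

theorem nodup_map {t : Tree O X} (h : t.leaves.Nodup) {f : X → Y} (hf : Function.Injective f) :
    (t.map f).leaves.Nodup := by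
  rw [Tree.map, leaves_bind]
  simp only [leaves]
  rw [← List.map_eq_flatMap]
  exact h.map hf

theorem mem_leaves_map {t : Tree O X} {f : X → Y} {y : Y} :
    y ∈ (t.map f).leaves ↔ ∃ x ∈ t.leaves, f x = y := by
  rw [Tree.map, leaves_bind, List.mem_flatMap]
  simp only [leaves, List.mem_singleton, eq_comm]

theorem nodup_graft {t : Tree O X} (ht : t.leaves.Nodup) (x : X) {s : Tree O Y}
    (hs : s.leaves.Nodup) : (t.graft x s).leaves.Nodup := by
  rw [graft, leaves_bind, List.nodup_flatMap]
  refine ⟨fun a _ => ?_, ht.imp ?_⟩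
  · by_cases ha : a = x
    · rw [dif_pos ha]
      exact nodup_map hs Sum.inr_injective
    · rw [dif_neg ha]
      exact List.nodup_singleton _
  · intro a b hab p hp hp'
    by_cases ha : a = x
    · have hb : b ≠ x := fun hb => hab (ha.trans hb.symm)
      simp only [dif_pos ha, dif_neg hb, mem_leaves_map] at hp hp'
      simp only [leaves, List.mem_singleton] at hp'
      obtain ⟨y, -, rfl⟩ := hp
      exact Sum.inr_ne_inl hp'
    · by_cases hb : b = x
      · simp only [dif_pos hb, dif_neg ha, mem_leaves_map] at hp hp'
        simp only [leaves, List.mem_singleton] at hp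
        obtain ⟨y, -, rfl⟩ := hp'
        exact Sum.inr_ne_inl hp
      · simp only [dif_neg ha, dif_neg hb, leaves, List.mem_singleton] at hp hp'
        exact hab (congrArg Subtype.val (Sum.inl_injective (hp.symm.trans hp')))

theorem mem_leaves_graft {t : Tree O X} (ht : ∀ a, a ∈ t.leaves) (x : X) {s : Tree O Y}
    (hs : ∀ b, b ∈ s.leaves) (p : {a : X // a ≠ x} ⊕ Y) : p ∈ (t.graft x s).leaves := by
  rw [graft, leaves_bind, List.mem_flatMap]
  rcases p with a | b
  · refine ⟨a.1, ht _, ?_⟩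
    rw [dif_neg a.2]
    exact List.mem_singleton.2 rfl
  · refine ⟨x, ht _, ?_⟩
    rw [dif_pos rfl]
    exact mem_leaves_map.2 ⟨b, hs b, rfl⟩

theorem map_map (t : Tree O X) (f : X → Y) (g : Y → Z) : (t.map f).map g = t.map (g ∘ f) :=
  bind_bind _ _ _

open Classical in
theorem bind_graft (t : Tree O X) (x : X) (s : Tree O Y) (F : {a : X // a ≠ x} ⊕ Y → Tree O Z) :
    (t.graft x s).bind F =
      t.bind fun a => if h : a = x then s.bind (fun b => F (Sum.inr b)) else F (Sum.inl ⟨a, h⟩) := by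
  rw [graft, bind_bind]
  congr 1
  funext a
  by_cases ha : a = x
  · rw [dif_pos ha, dif_pos ha, Tree.map, bind_bind]
    rfl
  · rw [dif_neg ha, dif_neg ha]
    rfl

theorem map_graft {X' Y' : Type} (t : Tree O X) (x : X) (s : Tree O Y) (e : X → X') (f : Y → Y')
    (φ : {a : X // a ≠ x} ⊕ Y → {a : X' // a ≠ e x} ⊕ Y') (he : Function.Injective e)
    (hl : ∀ a ha, φ (Sum.inl ⟨a, ha⟩) = Sum.inl ⟨e a, fun h => ha (he h)⟩)
    (hr : ∀ b, φ (Sum.inr b) = Sum.inr (f b)) :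
    (t.graft x s).map φ = (t.map e).graft (e x) (s.map f) := by
  rw [Tree.map, bind_graft, graft, Tree.map, bind_bind]
  congr 1
  funext a
  by_cases ha : a = x
  · simp only [bind, ha, dif_pos, hr, Tree.map, bind_bind]
  · have ha' : e a ≠ e x := fun h => ha (he h)
    simp only [bind, dif_neg ha, dif_neg ha', hl]

theorem graft_graft_right (t : Tree O X) (x : X) (s : Tree O Y) (y : Y) (r : Tree O Z)
    (φ : {p : {a : X // a ≠ x} ⊕ Y // p ≠ Sum.inr y} ⊕ Z →
      {a : X // a ≠ x} ⊕ ({b : Y // b ≠ y} ⊕ Z))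
    (hl : ∀ a h, φ (Sum.inl ⟨Sum.inl a, h⟩) = Sum.inl a)
    (hm : ∀ b h h', φ (Sum.inl ⟨Sum.inr b, h⟩) = Sum.inr (Sum.inl ⟨b, h'⟩))
    (hr : ∀ c, φ (Sum.inr c) = Sum.inr (Sum.inr c)) :
    ((t.graft x s).graft (Sum.inr y) r).map φ = t.graft x (s.graft y r) := by
  rw [Tree.map, bind_graft, bind_graft, graft]
  congr 1
  funext a
  by_cases ha : a = x
  · simp only [dif_pos ha]
    rw [Tree.map, bind_graft]
    congr 1
    funext b
    by_cases hb : b = y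
    · simp only [hb, dif_pos, hr]
    · have hb' : (Sum.inr b : {a : X // a ≠ x} ⊕ Y) ≠ Sum.inr y := fun h =>
        hb (Sum.inr_injective h)
      simp only [dif_neg hb, dif_neg hb', hm b hb' hb]
  · simp only [dif_neg ha, reduceCtorEq, dite_false, hl]

theorem graft_graft_left (t : Tree O X) (x y : X) (hxy : x ≠ y) (s : Tree O Y) (r : Tree O Z)
    (φ : {p : {a : X // a ≠ x} ⊕ Y // p ≠ Sum.inl ⟨y, hxy.symm⟩} ⊕ Z →
      {p : {a : X // a ≠ y} ⊕ Z // p ≠ Sum.inl ⟨x, hxy⟩} ⊕ Y)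
    (hl : ∀ a hx hy h h', φ (Sum.inl ⟨Sum.inl ⟨a, hx⟩, h⟩) = Sum.inl ⟨Sum.inl ⟨a, hy⟩, h'⟩)
    (hm : ∀ b h, φ (Sum.inl ⟨Sum.inr b, h⟩) = Sum.inr b)
    (hr : ∀ c h, φ (Sum.inr c) = Sum.inl ⟨Sum.inr c, h⟩) :
    ((t.graft x s).graft (Sum.inl ⟨y, hxy.symm⟩) r).map φ =
      (t.graft y r).graft (Sum.inl ⟨x, hxy⟩) s := by
  rw [Tree.map, bind_graft, bind_graft]
  conv_rhs => rw [graft, bind_graft]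
  congr 1
  funext a
  by_cases ha : a = x
  · subst ha
    simp only [dif_pos, dif_neg hxy, reduceCtorEq, dite_false, hm]
    rfl
  · by_cases hb : a = y
    · subst hb
      simp only [dif_neg ha, dif_pos, reduceCtorEq, dite_false]
      congr 1
      funext c
      rw [hr c Sum.inr_ne_inl]
    · have h1 : (Sum.inl ⟨a, ha⟩ : {a : X // a ≠ x} ⊕ Y) ≠ Sum.inl ⟨y, hxy.symm⟩ := fun h =>
        hb (congrArg Subtype.val (Sum.inl_injective h))
      have h2 : (Sum.inl ⟨a, hb⟩ : {a : X // a ≠ y} ⊕ Z) ≠ Sum.inl ⟨x, hxy⟩ := fun h =>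
        ha (congrArg Subtype.val (Sum.inl_injective h))
      simp only [dif_neg ha, dif_neg hb, dif_neg h1, dif_neg h2]
      rw [hl a ha hb h1 h2]

theorem map_graft_leaf (t : Tree O X) (x : X) (u : Y) (φ : {a : X // a ≠ x} ⊕ Y → X)
    (hl : ∀ a, φ (Sum.inl a) = a.1) (hr : ∀ b, φ (Sum.inr b) = x) :
    (t.graft x (leaf u)).map φ = t := by
  rw [Tree.map, bind_graft]
  conv_rhs => rw [← bind_leaf t]
  congr 1
  funext a
  by_cases ha : a = x
  · simp only [dif_pos ha, bind, hr, ha]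
  · simp only [dif_neg ha, hl]

theorem map_leaf_graft (x : X) (s : Tree O Y) (φ : {a : X // a ≠ x} ⊕ Y → Y)
    (hr : ∀ b, φ (Sum.inr b) = b) : ((leaf x : Tree O X).graft x s).map φ = s := by
  rw [Tree.map, bind_graft]
  conv_rhs => rw [← bind_leaf s]
  simp only [bind, dif_pos, hr]

/-- `t.HasColour S χ c`: with the leaves coloured by `χ`, the colours match along all edges of `t`
and the root has colour `c`. -/
def HasColour (S : Signature I) (χ : X → I) : Tree S.Op X → I → Prop
  | leaf x, c => χ x = c
  | node g l r, c => S.out g = c ∧ HasColour S χ l (S.left g) ∧ HasColour S χ r (S.right g)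

theorem HasColour.bind {S : Signature I} {χ : X → I} {ψ : Y → I} {t : Tree S.Op X} {c : I}
    (h : HasColour S χ t c) (f : X → Tree S.Op Y) (hf : ∀ x, HasColour S ψ (f x) (χ x)) :
    HasColour S ψ (t.bind f) c := by
  induction t generalizing c with
  | leaf x =>
    have h' : χ x = c := h
    exact h' ▸ hf x
  | node o l r hl hr => exact ⟨h.1, hl h.2.1, hr h.2.2⟩

end Tree

/-- Coloured tree monomials with inputs `A` and output colour `c`: each element of `A` labels exactly
one leaf. -/
structure TreeMonomial (S : Signature I) (A : CSet I) (c : I) where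
  tree : Tree S.Op A.carrier
  hasColour : tree.HasColour S A.col c
  nodup : tree.leaves.Nodup
  mem : ∀ a, a ∈ tree.leaves

namespace TreeMonomial

variable {S : Signature I}

theorem ext' {A : CSet I} {c : I} {s t : TreeMonomial S A c} (h : s.tree = t.tree) : s = t := by
  cases s
  cases t
  congr

/-- Relabelling of the leaves of a tree monomial. -/
def map {A B : CSet I} {c : I} (e : CSet.Iso A B) (t : TreeMonomial S A c) :
    TreeMonomial S B c where
  tree := t.tree.map e.equiv
  hasColour := t.hasColour.bind _ fun a => e.col_eq a
  nodup := Tree.nodup_map t.nodup e.equiv.injective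
  mem b := Tree.mem_leaves_map.2 ⟨e.equiv.symm b, t.mem _, e.equiv.apply_symm_apply b⟩

/-- The degenerate tree. -/
def one (S : Signature I) (c : I) : TreeMonomial S (CSet.single c) c where
  tree := .leaf ()
  hasColour := rfl
  nodup := List.nodup_singleton _
  mem _ := List.mem_singleton.2 rfl

/-- Grafting of tree monomials. -/
noncomputable def graft {A B : CSet I} {c d : I} (x : A.carrier) (h : A.col x = d)
    (s : TreeMonomial S A c) (t : TreeMonomial S B d) : TreeMonomial S (A.graft x B) c where
  tree := s.tree.graft x t.tree
  hasColour := s.hasColour.bind _ fun a => by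
    by_cases ha : a = x
    · subst ha
      rw [dif_pos rfl, h]
      exact t.hasColour.bind _ fun b => rfl
    · rw [dif_neg ha]
      rfl
  nodup := Tree.nodup_graft s.nodup x t.nodup
  mem := Tree.mem_leaves_graft s.mem x t.mem

end TreeMonomial

section Free

variable (𝕜) (S : Signature I)

/-- The bilinear extension of the grafting of tree monomials. -/
noncomputable def freeComp {A B : CSet I} {c d : I} (x : A.carrier) (h : A.col x = d) :
    (TreeMonomial S A c →₀ 𝕜) →ₗ[𝕜] (TreeMonomial S B d →₀ 𝕜) →ₗ[𝕜]
      (TreeMonomial S (A.graft x B) c →₀ 𝕜) :=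
  Finsupp.lift _ 𝕜 _ fun s => Finsupp.lmapDomain 𝕜 𝕜 (TreeMonomial.graft x h s)

theorem freeComp_single {A B : CSet I} {c d : I} (x : A.carrier) (h : A.col x = d)
    (s : TreeMonomial S A c) (t : TreeMonomial S B d) (r r' : 𝕜) :
    freeComp 𝕜 S x h (Finsupp.single s r) (Finsupp.single t r') =
      Finsupp.single (TreeMonomial.graft x h s t) (r * r') := by
  simp [freeComp]


/-- The free coloured operad on a signature: operations are linear combinations of coloured tree
monomials, composition is grafting. -/
noncomputable def free : Operad.{u, u} 𝕜 I where
  obj A c := TreeMonomial S A c →₀ 𝕜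
  relabel e := Finsupp.lmapDomain 𝕜 𝕜 (TreeMonomial.map e)
  one c := Finsupp.single (TreeMonomial.one S c) 1
  comp x h := freeComp 𝕜 S x h
  relabel_refl {A c} μ := by
    have : TreeMonomial.map (S := S) (c := c) (CSet.Iso.refl A) = id :=
      funext fun t => TreeMonomial.ext' (Tree.bind_leaf _)
    rw [this, Finsupp.lmapDomain_id]
    rfl
  relabel_trans {A B C c} e f μ := by
    have : TreeMonomial.map (S := S) (c := c) (e.trans f) =
        TreeMonomial.map f ∘ TreeMonomial.map e :=
      funext fun t => TreeMonomial.ext' (Tree.map_map t.tree e.equiv f.equiv).symm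
    rw [this, Finsupp.lmapDomain_comp]
    rfl
  relabel_comp {A A' B B' c d} e f x h μ ν := by
    induction μ using Finsupp.induction_linear with
    | zero => simp only [map_zero, LinearMap.zero_apply]
    | add μ μ' hμ hμ' => simp only [map_add, LinearMap.add_apply, hμ, hμ']
    | single s r =>
    induction ν using Finsupp.induction_linear with
    | zero => simp only [map_zero]
    | add ν ν' hν hν' => simp only [map_add, hν, hν']
    | single t r' =>
    simp only [freeComp_single, Finsupp.lmapDomain_apply, Finsupp.mapDomain_single]
    congr 1
    exact TreeMonomial.ext' (Tree.map_graft _ _ _ _ _ _ e.equiv.injective (fun _ _ => rfl)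
      fun _ => rfl)
  one_comp {B c} ν := by
    induction ν using Finsupp.induction_linear with
    | zero => simp only [map_zero]
    | add ν ν' hν hν' => simp only [map_add, hν, hν']
    | single t r =>
    simp only [freeComp_single, Finsupp.lmapDomain_apply, Finsupp.mapDomain_single, one_mul]
    congr 1
    exact TreeMonomial.ext' (Tree.map_leaf_graft _ _ _ fun _ => rfl)
  comp_one {A c d} x h μ := by
    induction μ using Finsupp.induction_linear with
    | zero => simp only [map_zero, LinearMap.zero_apply]
    | add μ μ' hμ hμ' => simp only [map_add, LinearMap.add_apply, hμ, hμ']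
    | single s r =>
    simp only [freeComp_single, Finsupp.lmapDomain_apply, Finsupp.mapDomain_single, mul_one]
    congr 1
    exact TreeMonomial.ext' (Tree.map_graft_leaf _ _ _ _ (fun _ => rfl) fun _ => rfl)
  comp_seq {A B C c d d'} x hx y hy l μ ν := by
    induction l using Finsupp.induction_linear with
    | zero => simp only [map_zero, LinearMap.zero_apply]
    | add l l' hl hl' => simp only [map_add, LinearMap.add_apply, hl, hl']
    | single s r =>
    induction μ using Finsupp.induction_linear with
    | zero => simp only [map_zero, LinearMap.zero_apply]
    | add μ μ' hμ hμ' => simp only [map_add, LinearMap.add_apply, hμ, hμ']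
    | single t r' =>
    induction ν using Finsupp.induction_linear with
    | zero => simp only [map_zero]
    | add ν ν' hν hν' => simp only [map_add, hν, hν']
    | single t' r'' =>
    simp only [freeComp_single, Finsupp.lmapDomain_apply, Finsupp.mapDomain_single, mul_assoc]
    congr 1
    exact TreeMonomial.ext' (Tree.graft_graft_right _ _ _ _ _ _ (fun _ _ => rfl)
      (fun _ _ _ => rfl) fun _ => rfl)
  comp_par {A B C c d d'} x y hxy hx hy l μ ν := by
    induction l using Finsupp.induction_linear with
    | zero => simp only [map_zero, LinearMap.zero_apply]
    | add l l' hl hl' => simp only [map_add, LinearMap.add_apply, hl, hl']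
    | single s r =>
    induction μ using Finsupp.induction_linear with
    | zero => simp only [map_zero, LinearMap.zero_apply]
    | add μ μ' hμ hμ' => simp only [map_add, LinearMap.add_apply, hμ, hμ']
    | single t r' =>
    induction ν using Finsupp.induction_linear with
    | zero => simp only [map_zero, LinearMap.zero_apply]
    | add ν ν' hν hν' => simp only [map_add, LinearMap.add_apply, hν, hν']
    | single t' r'' =>
    simp only [freeComp_single, Finsupp.lmapDomain_apply, Finsupp.mapDomain_single]
    rw [mul_right_comm]
    congr 1
    exact TreeMonomial.ext' (Tree.graft_graft_left _ _ _ hxy _ _ _ (fun _ _ _ _ _ => rfl)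
      (fun _ _ => rfl) fun _ _ => rfl)

/-- The operation of the free operad given by one tree. -/
noncomputable def treeOp {S : Signature I} (A : CSet I) (c : I) (t : Tree S.Op A.carrier)
    (h : t.HasColour S A.col c) (hn : t.leaves.Nodup) (hm : ∀ a, a ∈ t.leaves) :
    (free 𝕜 S).obj A c :=
  Finsupp.single (⟨t, h, hn, hm⟩ : TreeMonomial S A c) (1 : 𝕜)

end Free

/-! ### The operads `DCom` and `LieR` -/

/-- The two colours: `fn` for functions (elements of the commutative algebra), `der` for
derivations. -/
inductive Colour : Type
  | fn
  | der

open Colour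

/-- The generating operations of `DCom`: the product `α` and the action `d`. -/
inductive DComOp : Type
  | α
  | d

/-- `α : fn ⊗ fn → fn` and `d : fn ⊗ der → fn`, where `d (f, D)` is the value of the derivation `D`
on `f`. -/
def DComSig : Signature Colour where
  Op := DComOp
  left := fun _ => fn
  right
    | .α => fn
    | .d => der
  out := fun _ => fn

/-- The generating operations of `LieR`: the product `α`, the Lie bracket `β`, the action `d` and the
module structure `m`. -/
inductive LieROp : Type
  | α
  | β
  | d
  | m

/-- `α : fn ⊗ fn → fn`, `β : der ⊗ der → der`, `d : fn ⊗ der → fn` and `m : fn ⊗ der → der`. -/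
def LieRSig : Signature Colour where
  Op := LieROp
  left
    | .α => fn
    | .β => der
    | .d => fn
    | .m => fn
  right
    | .α => fn
    | .β => der
    | .d => der
    | .m => der
  out
    | .α => fn
    | .β => der
    | .d => fn
    | .m => der

/-- A tree of `DCom` generators with leaves `0, …, n`, the leaf `i` being of colour `χ i`. -/
noncomputable abbrev dT (𝕜 : Type u) [Field 𝕜] {n : ℕ} (χ : Fin (n + 1) → Colour) (c : Colour)
    (t : Tree DComOp (Fin (n + 1)))
    (h : t.HasColour DComSig χ c) (hn : t.leaves.Nodup) (hm : ∀ a, a ∈ t.leaves) :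
    (free 𝕜 DComSig).obj (CSet.ofFin χ) c :=
  treeOp 𝕜 (S := DComSig) (CSet.ofFin χ) c t h hn hm

/-- A tree of `LieR` generators with leaves `0, …, n`, the leaf `i` being of colour `χ i`. -/
noncomputable abbrev lT (𝕜 : Type u) [Field 𝕜] {n : ℕ} (χ : Fin (n + 1) → Colour) (c : Colour)
    (t : Tree LieROp (Fin (n + 1)))
    (h : t.HasColour LieRSig χ c) (hn : t.leaves.Nodup) (hm : ∀ a, a ∈ t.leaves) :
    (free 𝕜 LieRSig).obj (CSet.ofFin χ) c :=
  treeOp 𝕜 (S := LieRSig) (CSet.ofFin χ) c t h hn hm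

section Relations

variable (𝕜 : Type u) [Field 𝕜]


/-- The defining relations of `DCom`: `α` is commutative and associative, and every derivation
satisfies the Leibniz rule. -/
inductive DComRel : ∀ (A : CSet Colour) (c : Colour), (free 𝕜 DComSig).obj A c → Prop
  | comm : DComRel (CSet.ofFin ![fn, fn]) fn
      (dT 𝕜 ![fn, fn] fn (.node .α (.leaf 0) (.leaf 1))
          ⟨rfl, rfl, rfl⟩ (by decide) (by decide) - dT 𝕜 ![fn, fn] fn (.node .α (.leaf 1) (.leaf 0))
          ⟨rfl, rfl, rfl⟩ (by decide) (by decide))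
  | assoc : DComRel (CSet.ofFin ![fn, fn, fn]) fn
      (dT 𝕜 ![fn, fn, fn] fn (.node .α (.node .α (.leaf 0) (.leaf 1)) (.leaf 2))
          ⟨rfl, ⟨rfl, rfl, rfl⟩, rfl⟩ (by decide) (by decide)
        - dT 𝕜 ![fn, fn, fn] fn (.node .α (.leaf 0) (.node .α (.leaf 1) (.leaf 2)))
          ⟨rfl, rfl, ⟨rfl, rfl, rfl⟩⟩ (by decide) (by decide))
  | leibniz : DComRel (CSet.ofFin ![fn, fn, der]) fn
      (dT 𝕜 ![fn, fn, der] fn (.node .d (.node .α (.leaf 0) (.leaf 1)) (.leaf 2))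
          ⟨rfl, ⟨rfl, rfl, rfl⟩, rfl⟩ (by decide) (by decide)
        - dT 𝕜 ![fn, fn, der] fn (.node .α (.leaf 0) (.node .d (.leaf 1) (.leaf 2)))
          ⟨rfl, rfl, ⟨rfl, rfl, rfl⟩⟩ (by decide) (by decide)
        - dT 𝕜 ![fn, fn, der] fn (.node .α (.node .d (.leaf 0) (.leaf 2)) (.leaf 1))
          ⟨rfl, ⟨rfl, rfl, rfl⟩, rfl⟩ (by decide) (by decide))

/-- The defining relations of `LieR`, i.e. the identities of a Lie-Rinehart algebra. -/
inductive LieRRel : ∀ (A : CSet Colour) (c : Colour), (free 𝕜 LieRSig).obj A c → Prop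
  | comm : LieRRel (CSet.ofFin ![fn, fn]) fn
      (lT 𝕜 ![fn, fn] fn (.node .α (.leaf 0) (.leaf 1))
          ⟨rfl, rfl, rfl⟩ (by decide) (by decide) - lT 𝕜 ![fn, fn] fn (.node .α (.leaf 1) (.leaf 0))
          ⟨rfl, rfl, rfl⟩ (by decide) (by decide))
  | skew : LieRRel (CSet.ofFin ![der, der]) der
      (lT 𝕜 ![der, der] der (.node .β (.leaf 0) (.leaf 1))
          ⟨rfl, rfl, rfl⟩ (by decide) (by decide) + lT 𝕜 ![der, der] der (.node .β (.leaf 1) (.leaf 0))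
          ⟨rfl, rfl, rfl⟩ (by decide) (by decide))
  | assoc : LieRRel (CSet.ofFin ![fn, fn, fn]) fn
      (lT 𝕜 ![fn, fn, fn] fn (.node .α (.node .α (.leaf 0) (.leaf 1)) (.leaf 2))
          ⟨rfl, ⟨rfl, rfl, rfl⟩, rfl⟩ (by decide) (by decide)
        - lT 𝕜 ![fn, fn, fn] fn (.node .α (.leaf 0) (.node .α (.leaf 1) (.leaf 2)))
          ⟨rfl, rfl, ⟨rfl, rfl, rfl⟩⟩ (by decide) (by decide))
  | jacobi : LieRRel (CSet.ofFin ![der, der, der]) der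
      (lT 𝕜 ![der, der, der] der (.node .β (.node .β (.leaf 0) (.leaf 1)) (.leaf 2))
          ⟨rfl, ⟨rfl, rfl, rfl⟩, rfl⟩ (by decide) (by decide)
        - lT 𝕜 ![der, der, der] der (.node .β (.node .β (.leaf 0) (.leaf 2)) (.leaf 1))
          ⟨rfl, ⟨rfl, rfl, rfl⟩, rfl⟩ (by decide) (by decide)
        - lT 𝕜 ![der, der, der] der (.node .β (.leaf 0) (.node .β (.leaf 1) (.leaf 2)))
          ⟨rfl, rfl, ⟨rfl, rfl, rfl⟩⟩ (by decide) (by decide))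
  | leibniz : LieRRel (CSet.ofFin ![fn, fn, der]) fn
      (lT 𝕜 ![fn, fn, der] fn (.node .d (.node .α (.leaf 0) (.leaf 1)) (.leaf 2))
          ⟨rfl, ⟨rfl, rfl, rfl⟩, rfl⟩ (by decide) (by decide)
        - lT 𝕜 ![fn, fn, der] fn (.node .α (.leaf 0) (.node .d (.leaf 1) (.leaf 2)))
          ⟨rfl, rfl, ⟨rfl, rfl, rfl⟩⟩ (by decide) (by decide)
        - lT 𝕜 ![fn, fn, der] fn (.node .α (.node .d (.leaf 0) (.leaf 2)) (.leaf 1))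
          ⟨rfl, ⟨rfl, rfl, rfl⟩, rfl⟩ (by decide) (by decide))
  | bracket_act : LieRRel (CSet.ofFin ![fn, der, der]) fn
      (lT 𝕜 ![fn, der, der] fn (.node .d (.leaf 0) (.node .β (.leaf 1) (.leaf 2)))
          ⟨rfl, rfl, ⟨rfl, rfl, rfl⟩⟩ (by decide) (by decide)
        - lT 𝕜 ![fn, der, der] fn (.node .d (.node .d (.leaf 0) (.leaf 2)) (.leaf 1))
          ⟨rfl, ⟨rfl, rfl, rfl⟩, rfl⟩ (by decide) (by decide)
        + lT 𝕜 ![fn, der, der] fn (.node .d (.node .d (.leaf 0) (.leaf 1)) (.leaf 2))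
          ⟨rfl, ⟨rfl, rfl, rfl⟩, rfl⟩ (by decide) (by decide))
  | smul_smul : LieRRel (CSet.ofFin ![fn, fn, der]) der
      (lT 𝕜 ![fn, fn, der] der (.node .m (.node .α (.leaf 0) (.leaf 1)) (.leaf 2))
          ⟨rfl, ⟨rfl, rfl, rfl⟩, rfl⟩ (by decide) (by decide)
        - lT 𝕜 ![fn, fn, der] der (.node .m (.leaf 0) (.node .m (.leaf 1) (.leaf 2)))
          ⟨rfl, rfl, ⟨rfl, rfl, rfl⟩⟩ (by decide) (by decide))
  | smul_act : LieRRel (CSet.ofFin ![fn, fn, der]) fn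
      (lT 𝕜 ![fn, fn, der] fn (.node .d (.leaf 0) (.node .m (.leaf 1) (.leaf 2)))
          ⟨rfl, rfl, ⟨rfl, rfl, rfl⟩⟩ (by decide) (by decide)
        - lT 𝕜 ![fn, fn, der] fn (.node .α (.node .d (.leaf 0) (.leaf 2)) (.leaf 1))
          ⟨rfl, ⟨rfl, rfl, rfl⟩, rfl⟩ (by decide) (by decide))
  /-- `[D, f E] = f [D, E] + D(f) E` with `f, D, E` the inputs `0, 1, 2`. -/
  | bracket_smul : LieRRel (CSet.ofFin ![fn, der, der]) der
      (lT 𝕜 ![fn, der, der] der (.node .β (.leaf 1) (.node .m (.leaf 0) (.leaf 2)))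
          ⟨rfl, rfl, ⟨rfl, rfl, rfl⟩⟩ (by decide) (by decide)
        - lT 𝕜 ![fn, der, der] der (.node .m (.leaf 0) (.node .β (.leaf 1) (.leaf 2)))
          ⟨rfl, rfl, ⟨rfl, rfl, rfl⟩⟩ (by decide) (by decide)
        - lT 𝕜 ![fn, der, der] der (.node .m (.node .d (.leaf 0) (.leaf 1)) (.leaf 2))
          ⟨rfl, ⟨rfl, rfl, rfl⟩, rfl⟩ (by decide) (by decide))

/-- The operad of commutative algebras with a space of derivations. -/
noncomputable def DCom : Operad.{u, u} 𝕜 Colour := (free 𝕜 DComSig).quotient (DComRel 𝕜)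

/-- The operad of Lie-Rinehart algebras. -/
noncomputable def LieR : Operad.{u, u} 𝕜 Colour := (free 𝕜 LieRSig).quotient (LieRRel 𝕜)

/-- The generator `α` of `DCom`. -/
noncomputable def DCom.α : (DCom 𝕜).obj (CSet.ofFin ![fn, fn]) fn :=
  ((free 𝕜 DComSig).ideal (DComRel 𝕜) _ _).mkQ (dT 𝕜 ![fn, fn] fn (.node .α (.leaf 0) (.leaf 1))
          ⟨rfl, rfl, rfl⟩ (by decide) (by decide))

/-- The generator `d` of `DCom`. -/
noncomputable def DCom.d : (DCom 𝕜).obj (CSet.ofFin ![fn, der]) fn :=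
  ((free 𝕜 DComSig).ideal (DComRel 𝕜) _ _).mkQ (dT 𝕜 ![fn, der] fn (.node .d (.leaf 0) (.leaf 1))
          ⟨rfl, rfl, rfl⟩ (by decide) (by decide))

/-- The generator `α` of `LieR`. -/
noncomputable def LieR.α : (LieR 𝕜).obj (CSet.ofFin ![fn, fn]) fn :=
  ((free 𝕜 LieRSig).ideal (LieRRel 𝕜) _ _).mkQ (lT 𝕜 ![fn, fn] fn (.node .α (.leaf 0) (.leaf 1))
          ⟨rfl, rfl, rfl⟩ (by decide) (by decide))

/-- The generator `d` of `LieR`. -/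
noncomputable def LieR.d : (LieR 𝕜).obj (CSet.ofFin ![fn, der]) fn :=
  ((free 𝕜 LieRSig).ideal (LieRRel 𝕜) _ _).mkQ (lT 𝕜 ![fn, der] fn (.node .d (.leaf 0) (.leaf 1))
          ⟨rfl, rfl, rfl⟩ (by decide) (by decide))

end Relations

end ColOp

-- Existence is formal: the three relations of `DCom` occur among those of `LieR`. Uniqueness holds
-- because a morphism out of a quotient of a free operad is determined by its values on corollas;
-- `subst_induction` breaks the substitution of several trees into a corolla into relabellings and
-- partial compositions.
--
-- Injectivity is proved with a model and a partial inverse, so that no normal form or basis is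
-- needed. Operations of `LieR` act on the Lie–Rinehart algebra of all derivations of a polynomial
-- ring. Take the ring of jets, with a variable `(a, w)` for each label `a` and each word `w` of
-- labels, and the derivations that prepend a letter to the word; words are used because derivatives
-- along different labels need not commute. Evaluating at the point sending `a` to the variable `(a,
-- [])` and the derivation along `a` turns an operation of the free operad on the generators of
-- `DCom` into a polynomial, which vanishes if the operation dies in `LieR`
-- (`jetEval_eq_zero_of_inIdeal`).
--
-- Conversely, the polynomial determines the class of the operation modulo `DCom`. All trees with
-- labels in `A`, modulo substituted `DCom` relations, form a non-unital commutative algebra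
-- `DComAlg` with derivations `d(-, v)`. Sending the variable `(a, w)` to the corresponding iterated
-- derivative defines `jetHom` into its unitization. It intertwines the derivations, so it carries
-- the polynomial of a tree to the class of that tree (`jetHom_eval`). Hence an operation with zero
-- polynomial is a combination of substituted relations among arbitrary, possibly badly coloured or
-- repetitive, trees. Projecting to genuine tree monomials (`multilinearPart_mem_ideal`) puts it in
-- the operadic ideal.
--
-- This settles output `fn`. No generator of `DCom` has output `der`, so there the only operations
-- are multiples of an identity, which evaluate to multiples of a variable.

universe w'

namespace ColOp

variable {𝕜 : Type u} [Field 𝕜] {I : Type}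

/-! ### Leaves, restriction and substitution of trees -/

namespace Tree

variable {O X Y Z : Type}

theorem leaves_map (f : X → Y) (t : Tree O X) : (t.map f).leaves = t.leaves.map f := by
  rw [Tree.map, leaves_bind]
  simp only [leaves]
  rw [← List.map_eq_flatMap]

theorem leaves_ne_nil (t : Tree O X) : t.leaves ≠ [] := by
  induction t with
  | leaf x => simp [leaves]
  | node o l r hl hr => simp [leaves, hl]

theorem exists_map_val (t : Tree O X) (p : X → Prop) (h : ∀ x ∈ t.leaves, p x) :
    ∃ t' : Tree O {x // p x}, t'.map Subtype.val = t := by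
  induction t with
  | leaf x => exact ⟨leaf ⟨x, h x (by simp [leaves])⟩, rfl⟩
  | node o l r hl hr =>
    simp only [leaves, List.mem_append] at h
    obtain ⟨l', rfl⟩ := hl fun x hx => h x (.inl hx)
    obtain ⟨r', rfl⟩ := hr fun x hx => h x (.inr hx)
    exact ⟨node o l' r', rfl⟩

theorem hasColour_map {S : Signature I} {χ : Y → I} (f : X → Y) (t : Tree S.Op X) (c : I) :
    (t.map f).HasColour S χ c ↔ t.HasColour S (χ ∘ f) c := by
  induction t generalizing c with
  | leaf x => rfl
  | node o l r hl hr =>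
    exact and_congr Iff.rfl (and_congr (hl _) (hr _))

/-- Following the edges of `t` down to a leaf, the colour required of the tree inserted there is
forced to be that of the leaf. -/
theorem HasColour.of_bind {S : Signature I} {χ : X → I} {ψ : Y → I} {t : Tree S.Op X} {c : I}
    (h : t.HasColour S χ c) {f : X → Tree S.Op Y} (hf : (t.bind f).HasColour S ψ c) :
    ∀ x ∈ t.leaves, (f x).HasColour S ψ (χ x) := by
  induction t generalizing c with
  | leaf x =>
    intro y hy
    obtain rfl := List.mem_singleton.1 hy
    have h' : χ y = c := h
    exact h' ▸ hf
  | node o l r hl hr =>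
    intro x hx
    rcases List.mem_append.1 hx with hx | hx
    · exact hl h.2.1 hf.2.1 x hx
    · exact hr h.2.2 hf.2.2 x hx

/-- The coloured set of the leaf labels of a tree. -/
abbrev support (A : CSet I) (t : Tree O A.carrier) : CSet I :=
  have : Nonempty {a // a ∈ t.leaves} :=
    (List.exists_mem_of_ne_nil _ t.leaves_ne_nil).elim fun a ha => ⟨⟨a, ha⟩⟩
  ⟨{a // a ∈ t.leaves}, fun a => A.col a.1⟩

/-- Partial composition inserts an operation with its own set of inputs. A subtree whose leaves use
only some of the labels of `A` becomes such an operation over those labels. -/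
theorem exists_treeMonomial_support {S : Signature I} {A : CSet I} {c : I}
    {t : Tree S.Op A.carrier} (h : t.HasColour S A.col c) (hn : t.leaves.Nodup) :
    ∃ m : TreeMonomial S (support A t) c, m.tree.map Subtype.val = t := by
  obtain ⟨t', ht'⟩ := t.exists_map_val (· ∈ t.leaves) fun _ hx => hx
  have hl : t'.leaves.map Subtype.val = t.leaves := by rw [← leaves_map, ht']
  refine ⟨⟨t', (hasColour_map (χ := A.col) Subtype.val t' c).1 (by rwa [ht']), ?_, ?_⟩, ht'⟩
  · rw [← hl] at hn
    exact hn.of_map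
  · intro a
    have ha : a.1 ∈ t'.leaves.map Subtype.val := by
      rw [hl]
      exact a.2
    obtain ⟨b, hb, hab⟩ := List.mem_map.1 ha
    exact Subtype.ext hab ▸ hb

end Tree

/-- A family of trees that can be substituted simultaneously for the leaves of a tree monomial with
inputs `B`, the result being a tree monomial with inputs `A`. -/
structure IsSubst {S : Signature I} {B A : CSet I} (f : B.carrier → Tree S.Op A.carrier) :
    Prop where
  hasColour : ∀ b, (f b).HasColour S A.col (B.col b)
  nodup : ∀ b, (f b).leaves.Nodup
  disjoint : ∀ b b' a, a ∈ (f b).leaves → a ∈ (f b').leaves → b = b'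
  mem : ∀ a, ∃ b, a ∈ (f b).leaves

namespace TreeMonomial

variable {S : Signature I} {A B : CSet I} {c : I}

/-- Simultaneous substitution into a tree monomial. -/
def subst {f : B.carrier → Tree S.Op A.carrier} (hf : IsSubst f) (m : TreeMonomial S B c) :
    TreeMonomial S A c where
  tree := m.tree.bind f
  hasColour := m.hasColour.bind f hf.hasColour
  nodup := by
    rw [Tree.leaves_bind, List.nodup_flatMap]
    exact ⟨fun b _ => hf.nodup b, m.nodup.imp fun hab a ha hb => hab (hf.disjoint _ _ a ha hb)⟩
  mem a := by
    obtain ⟨b, hb⟩ := hf.mem a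
    rw [Tree.leaves_bind, List.mem_flatMap]
    exact ⟨b, m.mem b, hb⟩

/-- Every element of `B` labels a leaf of `m`, so one well-formed result already reveals every tree
of the family. Admissibility therefore depends on `f` alone and passes to all other monomials with
inputs `B`. -/
theorem isSubst_of_bind (m : TreeMonomial S B c) {f : B.carrier → Tree S.Op A.carrier}
    {m' : TreeMonomial S A c} (h : m'.tree = m.tree.bind f) : IsSubst f := by
  have hn := m'.nodup
  rw [h, Tree.leaves_bind, List.nodup_flatMap] at hn
  refine ⟨fun b => m.hasColour.of_bind (h ▸ m'.hasColour) b (m.mem b),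
    fun b => hn.1 b (m.mem b), fun b b' a hb hb' => ?_, fun a => ?_⟩
  · have : Std.Symm (Function.onFun List.Disjoint fun b => (f b).leaves) :=
      ⟨fun _ _ h => h.symm⟩
    by_contra hne
    exact hn.2.forall (m.mem b) (m.mem b') hne hb hb'
  · have := m'.mem a
    rw [h, Tree.leaves_bind, List.mem_flatMap] at this
    exact this.imp fun _ h => h.2

end TreeMonomial

/-- Splitting off one of the trees of a substitution. -/
theorem IsSubst.split {S : Signature I} {A B : CSet I} {f : B.carrier → Tree S.Op A.carrier}
    (hf : IsSubst f) (b : B.carrier) :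
    IsSubst (B := B.graft b (Tree.support A (f b))) (A := A)
      (Sum.elim (fun b' => f b'.1) fun a => Tree.leaf a.1) where
  hasColour := by
    rintro (b' | a)
    · exact hf.hasColour _
    · rfl
  nodup := by
    rintro (b' | a)
    · exact hf.nodup _
    · exact List.nodup_singleton _
  disjoint := by
    rintro (b₁ | a₁) (b₂ | a₂) a h h'
    · exact congrArg Sum.inl (Subtype.ext (hf.disjoint _ _ a h h'))
    · obtain rfl := List.mem_singleton.1 h'
      exact absurd (hf.disjoint _ _ _ h a₂.2) b₁.2
    · obtain rfl := List.mem_singleton.1 h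
      exact absurd (hf.disjoint _ _ _ h' a₁.2) b₂.2
    · obtain rfl := List.mem_singleton.1 h
      exact congrArg Sum.inr (Subtype.ext (List.mem_singleton.1 h'))
  mem a := by
    obtain ⟨b', hb'⟩ := hf.mem a
    by_cases h : b' = b
    · subst h
      exact ⟨Sum.inr ⟨a, hb'⟩, List.mem_singleton.2 rfl⟩
    · exact ⟨Sum.inl ⟨b', h⟩, hb'⟩

/-- A partial composition at `b` inserts the tree `f b`; in the substitution that remains, its
inputs only receive leaves. This is the recursion that reduces simultaneous substitution to partial
compositions. -/
theorem TreeMonomial.subst_split {S : Signature I} {A B : CSet I} {c : I}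
    {f : B.carrier → Tree S.Op A.carrier} (hf : IsSubst f) (b : B.carrier)
    (t : TreeMonomial S (Tree.support A (f b)) (B.col b)) (ht : t.tree.map Subtype.val = f b)
    (m : TreeMonomial S B c) :
    (m.graft b rfl t).subst (hf.split b) = m.subst hf := by
  refine TreeMonomial.ext' ?_
  change (m.tree.graft b t.tree).bind _ = m.tree.bind f
  rw [Tree.bind_graft]
  congr 1
  funext a
  by_cases ha : a = b
  · subst ha
    rw [dif_pos rfl]
    exact ht
  · rw [dif_neg ha]
    rfl

/-- A property of operations stable under relabelling and under partial composition with the trees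
of a substitution is stable under this substitution. -/
theorem subst_induction {S : Signature I}
    (J : ∀ (A : CSet I) (c : I), (TreeMonomial S A c →₀ 𝕜) → Prop)
    (H : ∀ (A : CSet I) (c : I), TreeMonomial S A c → Prop)
    (hrel : ∀ {A B : CSet I} {c : I} (e : CSet.Iso A B) (μ : TreeMonomial S A c →₀ 𝕜),
      J A c μ → J B c (Finsupp.lmapDomain 𝕜 𝕜 (TreeMonomial.map e) μ))
    (hcomp : ∀ {A B : CSet I} {c d : I} (x : A.carrier) (h : A.col x = d)
      (μ : TreeMonomial S A c →₀ 𝕜) (m : TreeMonomial S B d), J A c μ → H B d m →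
        J (A.graft x B) c (freeComp 𝕜 S x h μ (Finsupp.single m 1)))
    {A : CSet I} {c : I} (n : ℕ) : ∀ {B : CSet I} {f : B.carrier → Tree S.Op A.carrier}
    (hf : IsSubst f) (s : Finset B.carrier), s.card = n → (∀ b ∉ s, ∃ a, f b = .leaf a) →
    (∀ b ∈ s, ∀ m : TreeMonomial S (Tree.support A (f b)) (B.col b),
      m.tree.map Subtype.val = f b → H _ _ m) →
    ∀ μ : TreeMonomial S B c →₀ 𝕜, J B c μ →
      J A c (Finsupp.lmapDomain 𝕜 𝕜 (TreeMonomial.subst hf) μ) := by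
  classical
  induction n with
  | zero =>
    intro B f hf s hs hleaf _ μ hμ
    obtain rfl := Finset.card_eq_zero.1 hs
    -- No genuine tree is left to insert. Disjointness and covering make the leaf labels a
    -- bijection, so the substitution is a relabelling.
    choose e he using fun b => hleaf b (Finset.notMem_empty _)
    have hmem : ∀ b, e b ∈ (f b).leaves := fun b => by
      rw [he]; exact List.mem_singleton.2 rfl
    have hbij : Function.Bijective e := by
      refine ⟨fun b b' h => hf.disjoint b b' (e b) (hmem b) (h ▸ hmem b'), fun a => ?_⟩
      obtain ⟨b, hb⟩ := hf.mem a
      rw [he] at hb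
      exact ⟨b, (List.mem_singleton.1 hb).symm⟩
    let ε : CSet.Iso B A := ⟨Equiv.ofBijective e hbij, fun b => by
      have := hf.hasColour b
      rw [he] at this
      exact this⟩
    have : TreeMonomial.subst (c := c) hf = TreeMonomial.map ε := by
      funext m
      refine TreeMonomial.ext' ?_
      change m.tree.bind f = m.tree.map e
      rw [show f = fun b => .leaf (e b) from funext he]
      rfl
    rw [this]
    exact hrel ε μ hμ
  | succ n ih =>
    intro B f hf s hs hleaf hH μ hμ
    obtain ⟨b, hb⟩ : s.Nonempty := Finset.card_pos.1 (by omega)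
    obtain ⟨t, ht⟩ := Tree.exists_treeMonomial_support (hf.hasColour b) (hf.nodup b)
    -- Compose with `f b` at `b` first. The set of inputs that may still receive a non-trivial tree
    -- loses `b`, and the new inputs contribute nothing to it.
    have key := ih (hf.split b) ((s.subtype (· ≠ b)).map Function.Embedding.inl) (by
        rw [Finset.card_map, Finset.card_subtype, Finset.filter_ne', Finset.card_erase_of_mem hb,
          hs, Nat.add_sub_cancel]) (by
        rintro (b' | a) hb'
        · refine hleaf b'.1 fun h => hb' ?_
          exact Finset.mem_map.2 ⟨b', Finset.mem_subtype.2 h, rfl⟩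
        · exact ⟨a.1, rfl⟩) (by
        intro b' hb'
        obtain ⟨b'', hs'', rfl⟩ := Finset.mem_map.1 hb'
        exact hH b''.1 (Finset.mem_subtype.1 hs'')) _ (hcomp b rfl μ t hμ (hH b hb t ht))
    convert key using 1
    clear hμ key
    induction μ using Finsupp.induction_linear with
    | zero => simp only [map_zero, LinearMap.zero_apply]
    | add μ μ' h h' => simp only [map_add, LinearMap.add_apply, h, h']
    | single m r =>
      simp only [freeComp_single, Finsupp.lmapDomain_apply, Finsupp.mapDomain_single, mul_one]
      rw [TreeMonomial.subst_split hf b t ht m]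

/-- The element of the ideal stays the outer factor throughout, so relabelling and `comp_left`
suffice and no condition on the inserted trees is needed. -/
theorem Operad.ideal_subst {S : Signature I}
    (R : ∀ (A : CSet I) (c : I), (free 𝕜 S).obj A c → Prop) {A B : CSet I} {c : I}
    {f : B.carrier → Tree S.Op A.carrier} (hf : IsSubst f) (μ : TreeMonomial S B c →₀ 𝕜)
    (hμ : (free 𝕜 S).InIdeal R B c μ) :
    (free 𝕜 S).InIdeal R A c (Finsupp.lmapDomain 𝕜 𝕜 (TreeMonomial.subst hf) μ) := by
  have := Fintype.ofFinite B.carrier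
  exact subst_induction (fun A c μ => (free 𝕜 S).InIdeal R A c μ) (fun _ _ _ => True)
    (fun e μ h => Operad.InIdeal.relabel (P := free 𝕜 S) e μ h)
    (fun x h μ m hμ _ => Operad.InIdeal.comp_left (P := free 𝕜 S) x h μ (Finsupp.single m 1) hμ)
    _ hf Finset.univ rfl (fun b hb => absurd (Finset.mem_univ b) hb) (fun _ _ _ _ => trivial) μ hμ

/-! ### Morphisms from free operads and from quotients -/

/-- The composite of two morphisms of operads. -/
def Operad.Hom.comp {P : Operad.{u, v} 𝕜 I} {Q : Operad.{u, w} 𝕜 I}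
    {T : Operad.{u, w'} 𝕜 I} (G : Q.Hom T) (F : P.Hom Q) : P.Hom T where
  app A c := G.app A c ∘ₗ F.app A c
  app_relabel e μ := by simp only [LinearMap.comp_apply, F.app_relabel, G.app_relabel]
  app_one c := by simp only [LinearMap.comp_apply, F.app_one, G.app_one]
  app_comp x h μ ν := by simp only [LinearMap.comp_apply, F.app_comp, G.app_comp]

/-- The projection to a quotient operad. -/
def Operad.proj (P : Operad.{u, v} 𝕜 I) (R : ∀ (A : CSet I) (c : I), P.obj A c → Prop) :
    P.Hom (P.quotient R) where
  app A c := (P.ideal R A c).mkQ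
  app_relabel _ _ := rfl
  app_one _ := rfl
  app_comp _ _ _ _ := rfl

theorem Operad.InIdeal.map {P : Operad.{u, v} 𝕜 I} {Q : Operad.{u, w} 𝕜 I} (F : P.Hom Q)
    {R : ∀ (A : CSet I) (c : I), P.obj A c → Prop} {R' : ∀ (A : CSet I) (c : I), Q.obj A c → Prop}
    (h : ∀ A c μ, R A c μ → Q.InIdeal R' A c (F.app A c μ)) {A : CSet I} {c : I} {μ : P.obj A c}
    (hμ : P.InIdeal R A c μ) : Q.InIdeal R' A c (F.app A c μ) := by
  induction hμ with
  | of μ hμ => exact h _ _ μ hμ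
  | zero => rw [map_zero]; exact .zero
  | add μ ν _ _ hμ hν => rw [map_add]; exact .add _ _ hμ hν
  | smul r μ _ hμ => rw [map_smul]; exact .smul _ _ hμ
  | relabel e μ _ hμ => rw [F.app_relabel]; exact .relabel _ _ hμ
  | comp_left x h μ ν _ hμ => rw [F.app_comp]; exact .comp_left _ _ _ _ hμ
  | comp_right x h μ ν _ hν => rw [F.app_comp]; exact .comp_right _ _ _ _ hν

/-- The morphism of quotient operads induced by a morphism respecting the relations. -/
def Operad.quotientMap {P : Operad.{u, v} 𝕜 I} {Q : Operad.{u, w} 𝕜 I} (F : P.Hom Q)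
    {R : ∀ (A : CSet I) (c : I), P.obj A c → Prop} {R' : ∀ (A : CSet I) (c : I), Q.obj A c → Prop}
    (h : ∀ A c μ, R A c μ → Q.InIdeal R' A c (F.app A c μ)) :
    (P.quotient R).Hom (Q.quotient R') where
  app A c := (P.ideal R A c).mapQ (Q.ideal R' A c) (F.app A c) fun _ hμ =>
    Operad.InIdeal.map F h hμ
  app_relabel e μ := by
    obtain ⟨μ, rfl⟩ := Submodule.mkQ_surjective _ μ
    exact congrArg (Q.ideal R' _ _).mkQ (F.app_relabel e μ)
  app_one c := congrArg (Q.ideal R' _ _).mkQ (F.app_one c)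
  app_comp x h μ ν := by
    obtain ⟨μ, rfl⟩ := Submodule.mkQ_surjective _ μ
    obtain ⟨ν, rfl⟩ := Submodule.mkQ_surjective _ ν
    exact congrArg (Q.ideal R' _ _).mkQ (F.app_comp x h μ ν)

/-- The tree monomial with a single vertex. -/
def TreeMonomial.corolla (S : Signature I) (g : S.Op) :
    TreeMonomial S (CSet.ofFin ![S.left g, S.right g]) (S.out g) where
  tree := .node g (.leaf 0) (.leaf 1)
  hasColour := ⟨rfl, rfl, rfl⟩
  nodup := by simp [Tree.leaves]
  mem := by simp [Tree.leaves, Fin.forall_fin_two]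

/-- Each input labels a leaf, so a tree that is a single leaf has a single input and is a relabelled
identity. This is the base case for uniqueness of morphisms. -/
theorem TreeMonomial.eq_map_one {S : Signature I} {A : CSet I} {c : I} (m : TreeMonomial S A c)
    {a : A.carrier} (h : m.tree = .leaf a) :
    ∃ e : CSet.Iso (CSet.single c) A, m = (TreeMonomial.one S c).map e := by
  have hu : ∀ b, b = a := fun b => by
    have := m.mem b
    rw [h] at this
    exact List.mem_singleton.1 this
  have hc := m.hasColour
  rw [h] at hc
  refine ⟨⟨⟨fun _ => a, fun _ => (), fun _ => rfl, fun b => (hu b).symm⟩, fun _ => hc⟩, ?_⟩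
  exact TreeMonomial.ext' h

/-- Two morphisms from a free operad agreeing on the generators are equal. -/
theorem Operad.Hom.free_ext {S : Signature I} {Q : Operad.{u, w} 𝕜 I} {F G : (free 𝕜 S).Hom Q}
    (h : ∀ g, F.app _ _ (Finsupp.single (TreeMonomial.corolla S g) (1 : 𝕜)) =
      G.app _ _ (Finsupp.single (TreeMonomial.corolla S g) (1 : 𝕜))) : F = G := by
  have key : ∀ (n : ℕ) (A : CSet I) (c : I) (m : TreeMonomial S A c), m.tree.leaves.length ≤ n →
      F.app A c (Finsupp.single m (1 : 𝕜)) = G.app A c (Finsupp.single m (1 : 𝕜)) := by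
    intro n
    induction n with
    | zero =>
      intro A c m hm
      exact absurd (List.length_eq_zero_iff.1 (Nat.le_zero.1 hm)) m.tree.leaves_ne_nil
    | succ n ih =>
      intro A c m hm
      rcases ht : m.tree with a | ⟨g, l, r⟩
      · obtain ⟨e, rfl⟩ := m.eq_map_one ht
        have h1 := (F.app_relabel e ((free 𝕜 S).one c)).trans
          ((congrArg (Q.relabel e) ((F.app_one c).trans (G.app_one c).symm)).trans
            (G.app_relabel e ((free 𝕜 S).one c)).symm)
        have h2 : (free 𝕜 S).relabel e ((free 𝕜 S).one c) =
            Finsupp.single ((TreeMonomial.one S c).map e) (1 : 𝕜) := Finsupp.mapDomain_single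
        rwa [h2] at h1
      · have hc : S.out g = c := by
          have := m.hasColour
          rw [ht] at this
          exact this.1
        subst hc
        -- A tree with root `g` is the corolla of `g` with its two subtrees substituted.
        have hb : m.tree = (TreeMonomial.corolla S g).tree.bind ![l, r] := ht
        have hf := (TreeMonomial.corolla S g).isSubst_of_bind hb
        rw [ht] at hm
        simp only [Tree.leaves, List.length_append] at hm
        -- Each subtree has at least one leaf, so the other one has at most `n` and the induction
        -- hypothesis applies to both.
        have hl := List.length_pos_iff.2 l.leaves_ne_nil
        have hr := List.length_pos_iff.2 r.leaves_ne_nil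
        have := subst_induction (𝕜 := 𝕜) (fun A c μ => F.app A c μ = G.app A c μ)
          (fun A c m => F.app A c (Finsupp.single m (1 : 𝕜)) = G.app A c (Finsupp.single m (1 : 𝕜)))
          (fun e μ h => (F.app_relabel e μ).trans
            ((congrArg (Q.relabel e) h).trans (G.app_relabel e μ).symm))
          (fun x hx μ m h h' => (F.app_comp x hx μ (Finsupp.single m (1 : 𝕜))).trans
            ((congrArg₂ (fun a b => Q.comp x hx a b) h h').trans
              (G.app_comp x hx μ (Finsupp.single m (1 : 𝕜))).symm))
          2 hf Finset.univ rfl (fun b hb => absurd (Finset.mem_univ b) hb) (by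
            intro b _ m' hm'
            refine ih _ _ m' ?_
            have hlen := congrArg (fun t => t.leaves.length) hm'
            simp only [Tree.leaves_map, List.length_map] at hlen
            rw [hlen]
            revert b
            change ∀ b : Fin 2, _
            rw [Fin.forall_fin_two]
            constructor
            · intros
              change l.leaves.length ≤ n
              omega
            · intros
              change r.leaves.length ≤ n
              omega) _ (h g)
        rw [Finsupp.lmapDomain_apply, Finsupp.mapDomain_single] at this
        rwa [show m = (TreeMonomial.corolla S g).subst hf from TreeMonomial.ext' hb]
  refine Operad.Hom.ext ?_
  funext A c
  refine Finsupp.lhom_ext' fun m => LinearMap.ext_ring ?_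
  exact key _ A c m le_rfl

theorem Operad.Hom.quotient_ext {P : Operad.{u, v} 𝕜 I}
    {R : ∀ (A : CSet I) (c : I), P.obj A c → Prop} {Q : Operad.{u, w} 𝕜 I}
    {F G : (P.quotient R).Hom Q} (h : F.comp (P.proj R) = G.comp (P.proj R)) : F = G := by
  refine Operad.Hom.ext ?_
  funext A c
  refine Submodule.linearMap_qext _ ?_
  exact congrFun (congrFun (congrArg Operad.Hom.app h) A) c

/-! ### Change of signature -/

/-- Morphisms of signatures. -/
structure Signature.Hom (S S' : Signature I) where
  op : S.Op → S'.Op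
  left_op : ∀ g, S'.left (op g) = S.left g
  right_op : ∀ g, S'.right (op g) = S.right g
  out_op : ∀ g, S'.out (op g) = S.out g

namespace Tree

variable {O O' X Y : Type}

/-- Change of the marks of the vertices. -/
def mapOp (φ : O → O') : Tree O X → Tree O' X
  | leaf x => leaf x
  | node g l r => node (φ g) (l.mapOp φ) (r.mapOp φ)

theorem leaves_mapOp (φ : O → O') (t : Tree O X) : (t.mapOp φ).leaves = t.leaves := by
  induction t with
  | leaf x => rfl
  | node g l r hl hr => simp only [mapOp, leaves, hl, hr]

theorem mapOp_bind (φ : O → O') (t : Tree O X) (f : X → Tree O Y) :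
    (t.bind f).mapOp φ = (t.mapOp φ).bind fun x => (f x).mapOp φ := by
  induction t with
  | leaf x => rfl
  | node g l r hl hr => simp only [mapOp, bind, hl, hr]

theorem mapOp_map (φ : O → O') (t : Tree O X) (f : X → Y) :
    (t.map f).mapOp φ = (t.mapOp φ).map f := mapOp_bind _ _ _

theorem mapOp_graft (φ : O → O') (t : Tree O X) (x : X) (s : Tree O Y) :
    (t.graft x s).mapOp φ = (t.mapOp φ).graft x (s.mapOp φ) := by
  rw [graft, graft, mapOp_bind]
  congr 1
  funext a
  by_cases ha : a = x
  · rw [dif_pos ha, dif_pos ha, mapOp_map]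
  · rw [dif_neg ha, dif_neg ha, mapOp]

theorem HasColour.mapOp {S S' : Signature I} (φ : S.Hom S') {χ : X → I} {t : Tree S.Op X} {c : I}
    (h : t.HasColour S χ c) : (t.mapOp φ.op).HasColour S' χ c := by
  induction t generalizing c with
  | leaf x => exact h
  | node g l r hl hr =>
    refine ⟨(φ.out_op g).trans h.1, ?_, ?_⟩
    · rw [φ.left_op]
      exact hl h.2.1
    · rw [φ.right_op]
      exact hr h.2.2

end Tree

/-- Change of signature for tree monomials. -/
def TreeMonomial.mapOp {S S' : Signature I} (φ : S.Hom S') {A : CSet I} {c : I}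
    (m : TreeMonomial S A c) : TreeMonomial S' A c where
  tree := m.tree.mapOp φ.op
  hasColour := m.hasColour.mapOp φ
  nodup := by
    rw [Tree.leaves_mapOp]
    exact m.nodup
  mem a := by
    rw [Tree.leaves_mapOp]
    exact m.mem a

theorem lmapDomain_mapOp_freeComp {S S' : Signature I} (φ : S.Hom S') {A B : CSet I} {c d : I}
    (x : A.carrier) (h : A.col x = d) (μ : TreeMonomial S A c →₀ 𝕜) (ν : TreeMonomial S B d →₀ 𝕜) :
    Finsupp.lmapDomain 𝕜 𝕜 (TreeMonomial.mapOp φ) (freeComp 𝕜 S x h μ ν) =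
      freeComp 𝕜 S' x h (Finsupp.lmapDomain 𝕜 𝕜 (TreeMonomial.mapOp φ) μ)
        (Finsupp.lmapDomain 𝕜 𝕜 (TreeMonomial.mapOp φ) ν) := by
  induction μ using Finsupp.induction_linear with
  | zero => simp only [map_zero, LinearMap.zero_apply]
  | add μ μ' hμ hμ' => simp only [map_add, LinearMap.add_apply, hμ, hμ']
  | single s r =>
  induction ν using Finsupp.induction_linear with
  | zero => simp only [map_zero]
  | add ν ν' hν hν' => simp only [map_add, hν, hν']
  | single t r' =>
  simp only [freeComp_single, Finsupp.lmapDomain_apply, Finsupp.mapDomain_single]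
  congr 1
  exact TreeMonomial.ext' (Tree.mapOp_graft _ _ _ _)

/-- The morphism of free operads induced by a morphism of signatures. -/
noncomputable def freeMap {S S' : Signature I} (φ : S.Hom S') : (free 𝕜 S).Hom (free 𝕜 S') where
  app A c := Finsupp.lmapDomain 𝕜 𝕜 (TreeMonomial.mapOp φ)
  app_relabel {A B c} e μ := by
    have : TreeMonomial.mapOp φ ∘ TreeMonomial.map (c := c) e =
        TreeMonomial.map e ∘ TreeMonomial.mapOp φ :=
      funext fun m => TreeMonomial.ext' (Tree.mapOp_map _ _ _)
    refine (Finsupp.mapDomain_comp (v := μ)).symm.trans ?_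
    rw [this]
    exact Finsupp.mapDomain_comp
  app_one c := Finsupp.mapDomain_single
  app_comp x h μ ν := lmapDomain_mapOp_freeComp φ x h μ ν

/-! ### Evaluation of trees in a space with binary operations -/

section Eval

variable {V : Type w} [AddCommGroup V] [Module 𝕜 V]

/-- The value of a tree whose vertices are marked by bilinear operations on `V`. -/
def Tree.eval {O X : Type} (op : O → V →ₗ[𝕜] V →ₗ[𝕜] V) (ρ : X → V) : Tree O X → V
  | .leaf x => ρ x
  | .node g l r => op g (l.eval op ρ) (r.eval op ρ)

namespace Tree

variable {O X Y : Type} (op : O → V →ₗ[𝕜] V →ₗ[𝕜] V)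

theorem eval_bind (t : Tree O X) (f : X → Tree O Y) (ρ : Y → V) :
    (t.bind f).eval op ρ = t.eval op fun x => (f x).eval op ρ := by
  induction t with
  | leaf x => rfl
  | node g l r hl hr => simp only [bind, eval, hl, hr]

open Classical in
theorem eval_graft (t : Tree O X) (x : X) (s : Tree O Y) (ρ : {a : X // a ≠ x} ⊕ Y → V) :
    (t.graft x s).eval op ρ =
      t.eval op (Function.update (fun a => if h : a = x then 0 else ρ (Sum.inl ⟨a, h⟩)) x
        (s.eval op (ρ ∘ Sum.inr))) := by
  rw [graft, eval_bind]
  congr 1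
  funext a
  by_cases ha : a = x
  · subst ha
    rw [dif_pos rfl, Function.update_self, Tree.map, eval_bind]
    rfl
  · rw [dif_neg ha, Function.update_of_ne ha, dif_neg ha, eval]

theorem eval_congr (t : Tree O X) {ρ ρ' : X → V} (h : ∀ x ∈ t.leaves, ρ x = ρ' x) :
    t.eval op ρ = t.eval op ρ' := by
  induction t with
  | leaf x => exact h x (List.mem_singleton.2 rfl)
  | node g l r hl hr =>
    simp only [leaves, List.mem_append] at h
    simp only [eval]
    rw [hl fun x hx => h x (.inl hx), hr fun x hx => h x (.inr hx)]

theorem eval_update_of_notMem [DecidableEq X] (t : Tree O X) {x : X} (hx : x ∉ t.leaves)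
    (ρ : X → V) (v : V) : t.eval op (Function.update ρ x v) = t.eval op ρ :=
  t.eval_congr op fun y hy => Function.update_of_ne (fun h : y = x => hx (h ▸ hy)) _ _

/-- The value of a tree depends linearly on the value of a label occurring exactly once. -/
theorem exists_eval_update_eq [DecidableEq X] (t : Tree O X) (hn : t.leaves.Nodup) {x : X}
    (hx : x ∈ t.leaves) (ρ : X → V) :
    ∃ Φ : V →ₗ[𝕜] V, ∀ v, t.eval op (Function.update ρ x v) = Φ v := by
  induction t with
  | leaf y =>
    obtain rfl := List.mem_singleton.1 hx
    exact ⟨LinearMap.id, fun v => Function.update_self _ _ _⟩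
  | node g l r hl hr =>
    obtain ⟨hnl, hnr, hd⟩ := List.nodup_append.1 hn
    rcases List.mem_append.1 hx with hx | hx
    · obtain ⟨Φ, hΦ⟩ := hl hnl hx
      refine ⟨(op g).flip (r.eval op ρ) ∘ₗ Φ, fun v => ?_⟩
      rw [eval, hΦ, r.eval_update_of_notMem op fun h => hd _ hx _ h rfl]
      rfl
    · obtain ⟨Φ, hΦ⟩ := hr hnr hx
      refine ⟨op g (l.eval op ρ) ∘ₗ Φ, fun v => ?_⟩
      rw [eval, hΦ, l.eval_update_of_notMem op fun h => hd _ h _ hx rfl]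
      rfl

end Tree

variable {S : Signature I} (op : S.Op → V →ₗ[𝕜] V →ₗ[𝕜] V)

/-- The linear extension of the evaluation of tree monomials. -/
noncomputable def freeEval {A : CSet I} (c : I) (ρ : A.carrier → V) :
    (free 𝕜 S).obj A c →ₗ[𝕜] V :=
  Finsupp.linearCombination 𝕜 fun m : TreeMonomial S A c => m.tree.eval op ρ

theorem freeEval_single {A : CSet I} (c : I) (ρ : A.carrier → V) (m : TreeMonomial S A c) (r : 𝕜) :
    freeEval op c ρ (Finsupp.single m r) = r • m.tree.eval op ρ :=
  Finsupp.linearCombination_single 𝕜 r m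

theorem freeEval_treeOp {A : CSet I} (c : I) (ρ : A.carrier → V) (t : Tree S.Op A.carrier)
    (h : t.HasColour S A.col c) (hn : t.leaves.Nodup) (hm : ∀ a, a ∈ t.leaves) :
    freeEval op c ρ (treeOp 𝕜 A c t h hn hm) = t.eval op ρ :=
  (freeEval_single op c ρ _ _).trans (one_smul _ _)

theorem freeEval_relabel {A B : CSet I} {c : I} (e : CSet.Iso A B) (ρ : B.carrier → V)
    (μ : TreeMonomial S A c →₀ 𝕜) :
    freeEval op c ρ (Finsupp.lmapDomain 𝕜 𝕜 (TreeMonomial.map e) μ) =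
      freeEval op c (ρ ∘ e.equiv) μ := by
  refine (Finsupp.linearCombination_mapDomain 𝕜 _ μ).trans ?_
  refine congrFun (congrArg _ (congrArg _ ?_)) μ
  funext m
  exact Tree.eval_bind _ _ _ _

open Classical in
theorem freeEval_freeComp_right {A B : CSet I} {c d : I} (x : A.carrier) (h : A.col x = d)
    (ρ : (A.graft x B).carrier → V) (μ : TreeMonomial S A c →₀ 𝕜) (m : TreeMonomial S B d) (r : 𝕜) :
    freeEval op c ρ (freeComp 𝕜 S x h μ (Finsupp.single m r)) =
      r • freeEval op c (Function.update (fun a => if h : a = x then 0 else ρ (Sum.inl ⟨a, h⟩)) x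
        (m.tree.eval op (ρ ∘ Sum.inr))) μ := by
  induction μ using Finsupp.induction_linear with
  | zero =>
    rw [map_zero, LinearMap.zero_apply]
    exact (map_zero _).trans ((congrArg _ (map_zero _)).trans (smul_zero _)).symm
  | add μ μ' hμ hμ' =>
    rw [map_add, LinearMap.add_apply]
    refine (map_add _ _ _).trans (.trans ?_ (congrArg _ (map_add _ _ _)).symm)
    rw [hμ, hμ', smul_add]
  | single s r' =>
    rw [freeComp_single, freeEval_single, freeEval_single, smul_smul, mul_comm]
    exact congrArg _ (Tree.eval_graft _ _ _ _ _)

/-- The input `x` occurs exactly once in `s`, so the value is linear in what is inserted there.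
Vanishing of the inner operation then forces vanishing of the composite. -/
theorem exists_freeEval_freeComp_left {A B : CSet I} {c d : I} (x : A.carrier) (h : A.col x = d)
    (ρ : (A.graft x B).carrier → V) (s : TreeMonomial S A c) (r : 𝕜) :
    ∃ Φ : V →ₗ[𝕜] V, ∀ ν : TreeMonomial S B d →₀ 𝕜,
      freeEval op c ρ (freeComp 𝕜 S x h (Finsupp.single s r) ν) =
        Φ (freeEval op d (ρ ∘ Sum.inr) ν) := by
  classical
  obtain ⟨Φ, hΦ⟩ := s.tree.exists_eval_update_eq op s.nodup (s.mem x)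
    (fun a => if h : a = x then 0 else ρ (Sum.inl ⟨a, h⟩))
  refine ⟨r • Φ, fun ν => ?_⟩
  induction ν using Finsupp.induction_linear with
  | zero =>
    rw [map_zero]
    exact (map_zero _).trans ((congrArg _ (map_zero _)).trans (map_zero _)).symm
  | add ν ν' hν hν' =>
    rw [map_add]
    refine (map_add _ _ _).trans (.trans ?_ (congrArg _ (map_add _ _ _)).symm)
    rw [hν, hν', map_add]
  | single t r' =>
    rw [freeComp_single, freeEval_single, freeEval_single, map_smul, LinearMap.smul_apply,
      smul_smul, mul_comm, ← hΦ]
    exact congrArg _ (Tree.eval_graft _ _ _ _ _)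

/-- Bilinear operations satisfying the relations satisfy their operadic consequences. -/
theorem freeEval_eq_zero_of_inIdeal {R : ∀ (A : CSet I) (c : I), (free 𝕜 S).obj A c → Prop}
    (hR : ∀ A c μ, R A c μ → ∀ ρ : A.carrier → V, freeEval op c ρ μ = 0) {A : CSet I} {c : I}
    {μ : (free 𝕜 S).obj A c} (hμ : (free 𝕜 S).InIdeal R A c μ) :
    ∀ ρ : A.carrier → V, freeEval op c ρ μ = 0 := by
  induction hμ with
  | of μ hμ => exact hR _ _ μ hμ
  | zero => exact fun _ => map_zero _
  | add μ ν _ _ hμ hν => intro ρ; rw [map_add, hμ, hν, add_zero]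
  | smul r μ _ hμ => intro ρ; rw [map_smul, hμ, smul_zero]
  | relabel e μ _ hμ => exact fun ρ => (freeEval_relabel op e ρ μ).trans (hμ _)
  | @comp_left A B c d x h μ ν _ hμ =>
    intro ρ
    -- For a single inner tree, the composite is `μ` evaluated at a modified point; the hypothesis
    -- covers all points.
    have : freeEval op c ρ ∘ₗ (free 𝕜 S).comp x h μ = 0 := by
      refine Finsupp.lhom_ext fun m r => ?_
      refine (freeEval_freeComp_right op x h ρ μ m r).trans ?_
      rw [hμ, smul_zero]
      rfl
    exact LinearMap.congr_fun this ν
  | @comp_right A B c d x h μ ν _ hν =>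
    intro ρ
    have : freeEval op c ρ ∘ₗ ((free 𝕜 S).comp x h).flip ν = 0 := by
      refine Finsupp.lhom_ext fun m r => ?_
      obtain ⟨Φ, hΦ⟩ := exists_freeEval_freeComp_left op x h ρ m r
      refine (hΦ ν).trans ?_
      rw [hν, map_zero]
      rfl
    exact LinearMap.congr_fun this μ

end Eval

/-! ### Lie–Rinehart operations on functions and derivations -/

section LieRinehart

variable {V : Type w} [AddCommGroup V] [Module 𝕜 V] (op : LieROp → V →ₗ[𝕜] V →ₗ[𝕜] V)

theorem freeEval_lT {n : ℕ} (χ : Fin (n + 1) → Colour) (c : Colour)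
    (t : Tree LieROp (Fin (n + 1))) (h : t.HasColour LieRSig χ c) (hn : t.leaves.Nodup)
    (hm : ∀ a, a ∈ t.leaves) (ρ : Fin (n + 1) → V) :
    freeEval (S := LieRSig) (A := CSet.ofFin χ) op c ρ (lT 𝕜 χ c t h hn hm) = t.eval op ρ :=
  freeEval_treeOp (S := LieRSig) (A := CSet.ofFin χ) op c ρ t h hn hm

/-- Bilinear operations satisfying the identities of a Lie–Rinehart algebra satisfy the relations of
`LieR`. -/
theorem freeEval_lieRRel_eq_zero
    (comm : ∀ a b, op .α a b - op .α b a = 0) (skew : ∀ a b, op .β a b + op .β b a = 0)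
    (assoc : ∀ a b c, op .α (op .α a b) c - op .α a (op .α b c) = 0)
    (jacobi : ∀ a b c, op .β (op .β a b) c - op .β (op .β a c) b - op .β a (op .β b c) = 0)
    (leibniz : ∀ a b c, op .d (op .α a b) c - op .α a (op .d b c) - op .α (op .d a c) b = 0)
    (bracket_act : ∀ a b c, op .d a (op .β b c) - op .d (op .d a c) b + op .d (op .d a b) c = 0)
    (smul_smul : ∀ a b c, op .m (op .α a b) c - op .m a (op .m b c) = 0)
    (smul_act : ∀ a b c, op .d a (op .m b c) - op .α (op .d a c) b = 0)
    (bracket_smul : ∀ a b c, op .β b (op .m a c) - op .m a (op .β b c) - op .m (op .d a b) c = 0)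
    {A : CSet Colour} {c : Colour} {μ : (free 𝕜 LieRSig).obj A c}
    (hμ : LieRRel 𝕜 A c μ) (ρ : A.carrier → V) :
    freeEval (S := LieRSig) op c ρ μ = 0 := by
  cases hμ
  case comm =>
    erw [map_sub, freeEval_lT, freeEval_lT]
    exact comm _ _
  case skew =>
    erw [map_add, freeEval_lT, freeEval_lT]
    exact skew _ _
  case assoc =>
    erw [map_sub, freeEval_lT, freeEval_lT]
    exact assoc _ _ _
  case jacobi =>
    erw [map_sub, map_sub, freeEval_lT, freeEval_lT, freeEval_lT]
    exact jacobi _ _ _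
  case leibniz =>
    erw [map_sub, map_sub, freeEval_lT, freeEval_lT, freeEval_lT]
    exact leibniz _ _ _
  case bracket_act =>
    erw [map_add, map_sub, freeEval_lT, freeEval_lT, freeEval_lT]
    exact bracket_act _ _ _
  case smul_smul =>
    erw [map_sub, freeEval_lT, freeEval_lT]
    exact smul_smul _ _ _
  case smul_act =>
    erw [map_sub, freeEval_lT, freeEval_lT]
    exact smul_act _ _ _
  case bracket_smul =>
    erw [map_sub, map_sub, freeEval_lT, freeEval_lT, freeEval_lT]
    exact bracket_smul _ _ _

end LieRinehart

section Derivations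

variable (𝕜) (R : Type w) [CommRing R] [Algebra 𝕜 R]

/-- The operations of the Lie–Rinehart algebra of all derivations of a commutative algebra, extended
by zero to arbitrary pairs of a function and a derivation. -/
noncomputable def derOp : LieROp → (R × Derivation 𝕜 R R) →ₗ[𝕜] (R × Derivation 𝕜 R R) →ₗ[𝕜]
    (R × Derivation 𝕜 R R)
  | .α => LinearMap.mk₂ 𝕜 (fun a b => (a.1 * b.1, 0)) (by simp [add_mul]) (by simp)
      (by simp [mul_add]) (by simp)
  | .β => LinearMap.mk₂ 𝕜 (fun a b => (0, ⁅a.2, b.2⁆)) (by simp) (by simp) (by simp) (by simp)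
  | .d => LinearMap.mk₂ 𝕜 (fun a b => (b.2 a.1, 0)) (by simp) (by simp) (by simp) (by simp)
  | .m => LinearMap.mk₂ 𝕜 (fun a b => (0, a.1 • b.2)) (by simp [add_smul]) (by simp [smul_assoc])
      (by simp) (by
        intro r a b
        ext
        · simp
        · simp)

theorem freeEval_derOp_eq_zero {A : CSet Colour} {c : Colour} {μ : (free 𝕜 LieRSig).obj A c}
    (hμ : LieRRel 𝕜 A c μ) (ρ : A.carrier → R × Derivation 𝕜 R R) :
    freeEval (S := LieRSig) (derOp 𝕜 R) c ρ μ = 0 := by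
  refine freeEval_lieRRel_eq_zero _ ?_ ?_ ?_ ?_ ?_ ?_ ?_ ?_ ?_ hμ ρ <;>
  intros <;>
  simp only [derOp, LinearMap.mk₂_apply] <;>
  -- Each identity is checked on the function component and, after applying to an element, on the
  -- derivation component.
  refine Prod.ext ?_ (Derivation.ext fun x => ?_) <;>
  simp [Derivation.commutator_apply] <;>
  ring

theorem freeEval_derOp_eq_zero_of_inIdeal {A : CSet Colour} {c : Colour}
    {μ : (free 𝕜 LieRSig).obj A c} (hμ : (free 𝕜 LieRSig).InIdeal (LieRRel 𝕜) A c μ)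
    (ρ : A.carrier → R × Derivation 𝕜 R R) : freeEval (S := LieRSig) (derOp 𝕜 R) c ρ μ = 0 :=
  freeEval_eq_zero_of_inIdeal (S := LieRSig) (derOp 𝕜 R)
    (fun _ _ _ h ρ => freeEval_derOp_eq_zero 𝕜 R h ρ) hμ ρ

end Derivations

/-! ### Trees with arbitrary leaf labels modulo relations -/

section TreeIdeal

variable {S : Signature I} (R : ∀ (A : CSet I) (c : I), (free 𝕜 S).obj A c → Prop)

/-- The linear combinations of trees with leaves in `X` (repetitions allowed) that are obtained by
substitution from the operadic ideal generated by `R`. -/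
noncomputable def treeIdeal (c : I) (X : Type) : Submodule 𝕜 (Tree S.Op X →₀ 𝕜) :=
  Submodule.span 𝕜 {k | ∃ (B : CSet I) (μ : TreeMonomial S B c →₀ 𝕜) (f : B.carrier → Tree S.Op X),
    (free 𝕜 S).InIdeal R B c μ ∧ Finsupp.lmapDomain 𝕜 𝕜 (fun m => m.tree.bind f) μ = k}

theorem mem_treeIdeal {c : I} {X : Type} {B : CSet I} {μ : TreeMonomial S B c →₀ 𝕜}
    (hμ : (free 𝕜 S).InIdeal R B c μ) (f : B.carrier → Tree S.Op X) :
    Finsupp.lmapDomain 𝕜 𝕜 (fun m => m.tree.bind f) μ ∈ treeIdeal R c X :=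
  Submodule.subset_span ⟨B, μ, f, hμ, rfl⟩

theorem lmapDomain_bind_freeComp_single {A B : CSet I} {c d : I} {X : Type} (x : A.carrier)
    (h : A.col x = d) (s : TreeMonomial S A c) (f : (A.graft x B).carrier → Tree S.Op X)
    (μ : TreeMonomial S B d →₀ 𝕜) :
    Finsupp.lmapDomain 𝕜 𝕜 (fun m => m.tree.bind f) (freeComp 𝕜 S x h (Finsupp.single s 1) μ) =
      Finsupp.lmapDomain 𝕜 𝕜 (fun m => (s.graft x h m).tree.bind f) μ := by
  induction μ using Finsupp.induction_linear with
  | zero => simp only [map_zero]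
  | add μ μ' h h' => simp only [map_add, h, h']
  | single m a =>
    simp only [freeComp_single, Finsupp.lmapDomain_apply, Finsupp.mapDomain_single, one_mul]

theorem TreeMonomial.corolla_graft_zero_bind (g : S.Op) {X : Type} {B : CSet I}
    (m : TreeMonomial S B (S.left g)) (r : Tree S.Op X) (f : B.carrier → Tree S.Op X) :
    ((TreeMonomial.corolla S g).graft 0 rfl m).tree.bind (Sum.elim (fun _ => r) f) =
      .node g (m.tree.bind f) r := by
  refine (Tree.bind_graft _ _ _ _).trans ?_
  simp [TreeMonomial.corolla, Tree.bind]

theorem TreeMonomial.corolla_graft_one_bind (g : S.Op) {X : Type} {B : CSet I}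
    (m : TreeMonomial S B (S.right g)) (l : Tree S.Op X) (f : B.carrier → Tree S.Op X) :
    ((TreeMonomial.corolla S g).graft 1 rfl m).tree.bind (Sum.elim (fun _ => l) f) =
      .node g l (m.tree.bind f) := by
  refine (Tree.bind_graft _ _ _ _).trans ?_
  simp [TreeMonomial.corolla, Tree.bind]

/-- Putting a root above a relation is partial composition of the corolla with that relation; the
free input of the corolla is then filled by `r`. This makes the operations descend to trees modulo
`treeIdeal`. -/
theorem lmapDomain_node_left_mem (g : S.Op) {X : Type} (r : Tree S.Op X)
    {k : Tree S.Op X →₀ 𝕜} (hk : k ∈ treeIdeal R (S.left g) X) :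
    Finsupp.lmapDomain 𝕜 𝕜 (fun t => Tree.node g t r) k ∈ treeIdeal R (S.out g) X := by
  induction hk using Submodule.span_induction with
  | zero => rw [map_zero]; exact zero_mem _
  | add k k' _ _ h h' => rw [map_add]; exact add_mem h h'
  | smul a k _ h => rw [map_smul]; exact Submodule.smul_mem _ a h
  | mem k hk =>
    obtain ⟨B, μ, f, hμ, rfl⟩ := hk
    have := mem_treeIdeal R (Operad.InIdeal.comp_right (P := free 𝕜 S)
      (A := CSet.ofFin ![S.left g, S.right g]) 0 rfl
      (Finsupp.single (TreeMonomial.corolla S g) (1 : 𝕜)) μ hμ) (Sum.elim (fun _ => r) f)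
    convert this using 1
    refine Eq.trans ?_ (lmapDomain_bind_freeComp_single (𝕜 := 𝕜)
      (A := CSet.ofFin ![S.left g, S.right g]) 0 rfl (TreeMonomial.corolla S g)
      (Sum.elim (fun _ => r) f) μ).symm
    have hcomp : (fun m => ((TreeMonomial.corolla S g).graft 0 rfl m).tree.bind
        (Sum.elim (fun _ => r) f)) = (fun t => Tree.node g t r) ∘ fun m => m.tree.bind f :=
      funext fun m => m.corolla_graft_zero_bind g r f
    refine Eq.trans ?_ (congrArg (fun h => Finsupp.lmapDomain 𝕜 𝕜 h μ) hcomp).symm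
    exact Finsupp.mapDomain_comp.symm

theorem lmapDomain_node_right_mem (g : S.Op) {X : Type} (l : Tree S.Op X)
    {k : Tree S.Op X →₀ 𝕜} (hk : k ∈ treeIdeal R (S.right g) X) :
    Finsupp.lmapDomain 𝕜 𝕜 (fun t => Tree.node g l t) k ∈ treeIdeal R (S.out g) X := by
  induction hk using Submodule.span_induction with
  | zero => rw [map_zero]; exact zero_mem _
  | add k k' _ _ h h' => rw [map_add]; exact add_mem h h'
  | smul a k _ h => rw [map_smul]; exact Submodule.smul_mem _ a h
  | mem k hk =>
    obtain ⟨B, μ, f, hμ, rfl⟩ := hk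
    have := mem_treeIdeal R (Operad.InIdeal.comp_right (P := free 𝕜 S)
      (A := CSet.ofFin ![S.left g, S.right g]) 1 rfl
      (Finsupp.single (TreeMonomial.corolla S g) (1 : 𝕜)) μ hμ) (Sum.elim (fun _ => l) f)
    convert this using 1
    refine Eq.trans ?_ (lmapDomain_bind_freeComp_single (𝕜 := 𝕜)
      (A := CSet.ofFin ![S.left g, S.right g]) 1 rfl (TreeMonomial.corolla S g)
      (Sum.elim (fun _ => l) f) μ).symm
    have hcomp : (fun m => ((TreeMonomial.corolla S g).graft 1 rfl m).tree.bind
        (Sum.elim (fun _ => l) f)) = (fun t => Tree.node g l t) ∘ fun m => m.tree.bind f :=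
      funext fun m => m.corolla_graft_one_bind g l f
    refine Eq.trans ?_ (congrArg (fun h => Finsupp.lmapDomain 𝕜 𝕜 h μ) hcomp).symm
    exact Finsupp.mapDomain_comp.symm

/-- The bilinear extension of the formation of trees with root marked by `g`. -/
noncomputable def treeMul {O X : Type} (g : O) :
    (Tree O X →₀ 𝕜) →ₗ[𝕜] (Tree O X →₀ 𝕜) →ₗ[𝕜] (Tree O X →₀ 𝕜) :=
  Finsupp.lift _ 𝕜 _ fun s => Finsupp.lmapDomain 𝕜 𝕜 fun t => Tree.node g s t

theorem treeMul_single_single {O X : Type} (g : O) (s t : Tree O X) (a b : 𝕜) :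
    treeMul g (Finsupp.single s a) (Finsupp.single t b) =
      Finsupp.single (Tree.node g s t) (a * b) := by
  simp [treeMul]

theorem treeMul_single_left {O X : Type} (g : O) (s : Tree O X) (a : 𝕜) (k : Tree O X →₀ 𝕜) :
    treeMul g (Finsupp.single s a) k =
      a • Finsupp.lmapDomain 𝕜 𝕜 (fun t => Tree.node g s t) k := by
  simp [treeMul]

theorem treeMul_single_right {O X : Type} (g : O) (s : Tree O X) (a : 𝕜) (k : Tree O X →₀ 𝕜) :
    treeMul g k (Finsupp.single s a) =
      a • Finsupp.lmapDomain 𝕜 𝕜 (fun t => Tree.node g t s) k := by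
  induction k using Finsupp.induction_linear with
  | zero => simp only [map_zero, LinearMap.zero_apply, smul_zero]
  | add k k' h h' => simp only [map_add, LinearMap.add_apply, h, h', smul_add]
  | single t b =>
    rw [treeMul_single_single, Finsupp.lmapDomain_apply, Finsupp.mapDomain_single,
      Finsupp.smul_single, smul_eq_mul, mul_comm]

theorem treeMul_mem_of_left (g : S.Op) {X : Type} {k : Tree S.Op X →₀ 𝕜}
    (hk : k ∈ treeIdeal R (S.left g) X) (l : Tree S.Op X →₀ 𝕜) :
    treeMul g k l ∈ treeIdeal R (S.out g) X := by
  induction l using Finsupp.induction_linear with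
  | zero => rw [map_zero]; exact zero_mem _
  | add l l' h h' => rw [map_add]; exact add_mem h h'
  | single t a =>
    rw [treeMul_single_right]
    exact Submodule.smul_mem _ a (lmapDomain_node_left_mem R g t hk)

theorem treeMul_mem_of_right (g : S.Op) {X : Type} {k : Tree S.Op X →₀ 𝕜}
    (hk : k ∈ treeIdeal R (S.right g) X) (l : Tree S.Op X →₀ 𝕜) :
    treeMul g l k ∈ treeIdeal R (S.out g) X := by
  induction l using Finsupp.induction_linear with
  | zero => rw [map_zero]; exact zero_mem _
  | add l l' h h' => rw [map_add, LinearMap.add_apply]; exact add_mem h h'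
  | single t a =>
    rw [treeMul_single_left]
    exact Submodule.smul_mem _ a (lmapDomain_node_right_mem R g t hk)

/-! ### Projection from arbitrary trees back to tree monomials -/

theorem TreeMonomial.tree_injective {A : CSet I} {c : I} :
    Function.Injective (TreeMonomial.tree : TreeMonomial S A c → Tree S.Op A.carrier) :=
  fun _ _ h => TreeMonomial.ext' h

/-- The part of a linear combination of trees supported on the tree monomials. -/
noncomputable def multilinearPart (A : CSet I) (c : I) :
    (Tree S.Op A.carrier →₀ 𝕜) →ₗ[𝕜] (TreeMonomial S A c →₀ 𝕜) :=
  Finsupp.lcomapDomain TreeMonomial.tree TreeMonomial.tree_injective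

theorem multilinearPart_single_tree {A : CSet I} {c : I} (m : TreeMonomial S A c) (a : 𝕜) :
    multilinearPart A c (Finsupp.single m.tree a) = Finsupp.single m a := by
  classical
  ext m'
  change Finsupp.single m.tree a m'.tree = _
  simp only [Finsupp.single_apply, TreeMonomial.tree_injective.eq_iff]

theorem multilinearPart_single_of_ne {A : CSet I} {c : I} {t : Tree S.Op A.carrier}
    (h : ∀ m : TreeMonomial S A c, m.tree ≠ t) (a : 𝕜) :
    multilinearPart A c (Finsupp.single t a) = 0 := by
  classical
  ext m'
  change Finsupp.single t a m'.tree = _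
  rw [Finsupp.single_apply, if_neg (h m').symm]
  rfl

theorem multilinearPart_lmapDomain_tree {A : CSet I} {c : I} (μ : TreeMonomial S A c →₀ 𝕜) :
    multilinearPart A c (Finsupp.lmapDomain 𝕜 𝕜 TreeMonomial.tree μ) = μ := by
  induction μ using Finsupp.induction_linear with
  | zero => simp only [map_zero]
  | add μ μ' h h' => simp only [map_add, h, h']
  | single m a =>
    rw [Finsupp.lmapDomain_apply, Finsupp.mapDomain_single, multilinearPart_single_tree]

/-- For a substituted relation there are two cases. If some monomial becomes a tree monomial over
`A`, then `f` is admissible and the whole relation is substituted within the operad; otherwise every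
term is discarded by the projection. -/
theorem multilinearPart_mem_ideal {A : CSet I} {c : I} {k : Tree S.Op A.carrier →₀ 𝕜}
    (hk : k ∈ treeIdeal R c A.carrier) : (free 𝕜 S).InIdeal R A c (multilinearPart A c k) := by
  induction hk using Submodule.span_induction with
  | zero => rw [map_zero]; exact Operad.InIdeal.zero (P := free 𝕜 S)
  | add k k' _ _ h h' => rw [map_add]; exact Operad.InIdeal.add (P := free 𝕜 S) _ _ h h'
  | smul a k _ h => rw [map_smul]; exact Operad.InIdeal.smul (P := free 𝕜 S) a _ h
  | mem k hk =>
    obtain ⟨B, μ, f, hμ, rfl⟩ := hk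
    by_cases hex : ∃ (s : TreeMonomial S B c) (m : TreeMonomial S A c), m.tree = s.tree.bind f
    · obtain ⟨s, m, hm⟩ := hex
      have hf := s.isSubst_of_bind hm
      have : multilinearPart A c (Finsupp.lmapDomain 𝕜 𝕜 (fun m => m.tree.bind f) μ) =
          Finsupp.lmapDomain 𝕜 𝕜 (TreeMonomial.subst hf) μ := by
        clear hμ
        induction μ using Finsupp.induction_linear with
        | zero => simp only [map_zero]
        | add μ μ' h h' => simp only [map_add, h, h']
        | single t a =>
          simp only [Finsupp.lmapDomain_apply, Finsupp.mapDomain_single]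
          exact multilinearPart_single_tree (t.subst hf) a
      rw [this]
      exact Operad.ideal_subst R hf μ hμ
    · push Not at hex
      have : multilinearPart A c (Finsupp.lmapDomain 𝕜 𝕜 (fun m => m.tree.bind f) μ) = 0 := by
        clear hμ
        induction μ using Finsupp.induction_linear with
        | zero => simp only [map_zero]
        | add μ μ' h h' => simp only [map_add, h, h', add_zero]
        | single t a =>
          simp only [Finsupp.lmapDomain_apply, Finsupp.mapDomain_single]
          exact multilinearPart_single_of_ne (hex t) a
      rw [this]
      exact Operad.InIdeal.zero (P := free 𝕜 S)

end TreeIdeal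

/-! ### The algebra of `DCom`-trees -/

section DComAlgebra

open Colour

variable (𝕜) (X : Type)

/-- The consequences of the relations of `DCom` of output colour `fn`, with leaves in `X`. -/
noncomputable def dComIdeal : Submodule 𝕜 (Tree DComOp X →₀ 𝕜) :=
  treeIdeal (S := DComSig) (DComRel 𝕜) fn X

/-- The linear combinations of trees in the generators of `DCom`, modulo the consequences of the
relations of `DCom`. -/
def DComAlg : Type u := (Tree DComOp X →₀ 𝕜) ⧸ dComIdeal 𝕜 X

noncomputable instance : AddCommGroup (DComAlg 𝕜 X) :=
  inferInstanceAs (AddCommGroup (_ ⧸ dComIdeal 𝕜 X))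

noncomputable instance : Module 𝕜 (DComAlg 𝕜 X) :=
  inferInstanceAs (Module 𝕜 (_ ⧸ dComIdeal 𝕜 X))

namespace DComAlg

variable {X}

/-- The class of a linear combination of trees. -/
noncomputable def mk : (Tree DComOp X →₀ 𝕜) →ₗ[𝕜] DComAlg 𝕜 X := (dComIdeal 𝕜 X).mkQ

theorem mk_eq_zero {k : Tree DComOp X →₀ 𝕜} : mk 𝕜 k = 0 ↔ k ∈ dComIdeal 𝕜 X :=
  Submodule.Quotient.mk_eq_zero _

/-- The class of a tree. -/
noncomputable def of (t : Tree DComOp X) : DComAlg 𝕜 X := mk 𝕜 (Finsupp.single t 1)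

theorem hom_ext {M : Type w} [AddCommGroup M] [Module 𝕜 M] {f g : DComAlg 𝕜 X →ₗ[𝕜] M}
    (h : ∀ t, f (of 𝕜 t) = g (of 𝕜 t)) : f = g :=
  Submodule.linearMap_qext _ (Finsupp.lhom_ext' fun t => LinearMap.ext_ring (h t))

/-- The bilinear extension of the operation `α`. -/
noncomputable def mulLin : DComAlg 𝕜 X →ₗ[𝕜] DComAlg 𝕜 X →ₗ[𝕜] DComAlg 𝕜 X :=
  (dComIdeal 𝕜 X).liftQ
    { toFun := fun k => (dComIdeal 𝕜 X).liftQ (mk 𝕜 ∘ₗ treeMul DComOp.α k) fun _ hl =>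
        (mk_eq_zero 𝕜).2 (treeMul_mem_of_right (S := DComSig) (DComRel 𝕜) DComOp.α hl k)
      map_add' := fun k k' => Submodule.linearMap_qext _ <| LinearMap.ext fun l =>
        congrArg (mk 𝕜) (LinearMap.congr_fun ((treeMul DComOp.α).map_add k k') l)
      map_smul' := fun r k => Submodule.linearMap_qext _ <| LinearMap.ext fun l =>
        congrArg (mk 𝕜) (LinearMap.congr_fun ((treeMul DComOp.α).map_smul r k) l) }
    fun _ hk => Submodule.linearMap_qext _ <| LinearMap.ext fun l =>
      (mk_eq_zero 𝕜).2 (treeMul_mem_of_left (S := DComSig) (DComRel 𝕜) DComOp.α hk l)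

theorem mulLin_of (s t : Tree DComOp X) : mulLin 𝕜 (of 𝕜 s) (of 𝕜 t) = of 𝕜 (.node .α s t) := by
  refine (congrArg (mk 𝕜) (treeMul_single_single DComOp.α s t 1 1)).trans ?_
  rw [one_mul, of]

/-- The linear extension of the operation `d` with fixed second argument. -/
noncomputable def dLin (v : X) : DComAlg 𝕜 X →ₗ[𝕜] DComAlg 𝕜 X :=
  (dComIdeal 𝕜 X).mapQ (dComIdeal 𝕜 X)
    (Finsupp.lmapDomain 𝕜 𝕜 fun t => Tree.node DComOp.d t (.leaf v))
    fun _ hk => lmapDomain_node_left_mem (S := DComSig) (DComRel 𝕜) DComOp.d (.leaf v) hk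

theorem dLin_of (v : X) (t : Tree DComOp X) : dLin 𝕜 v (of 𝕜 t) = of 𝕜 (.node .d t (.leaf v)) :=
  congrArg (mk 𝕜) Finsupp.mapDomain_single

theorem mk_lmapDomain_bind_dT {n : ℕ} (χ : Fin (n + 1) → Colour) (t : Tree DComOp (Fin (n + 1)))
    (h : t.HasColour DComSig χ fn) (hn : t.leaves.Nodup) (hm : ∀ a, a ∈ t.leaves)
    (f : Fin (n + 1) → Tree DComOp X) :
    mk 𝕜 (Finsupp.lmapDomain 𝕜 𝕜
      (fun m : TreeMonomial DComSig (CSet.ofFin χ) fn => m.tree.bind f) (dT 𝕜 χ fn t h hn hm)) =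
      of 𝕜 (t.bind f) :=
  congrArg (mk 𝕜) Finsupp.mapDomain_single

/-- Arbitrary trees may be substituted into the defining relation, so it holds without any condition
on colours or repeated labels. -/
theorem of_comm (a b : Tree DComOp X) : of 𝕜 (.node .α a b) = of 𝕜 (.node .α b a) := by
  have := (mk_eq_zero 𝕜).2 (mem_treeIdeal (S := DComSig) (DComRel 𝕜) (.of _ .comm) ![a, b])
  erw [map_sub, map_sub, mk_lmapDomain_bind_dT, mk_lmapDomain_bind_dT] at this
  exact sub_eq_zero.1 this

theorem of_assoc (a b c : Tree DComOp X) :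
    of 𝕜 (.node .α (.node .α a b) c) = of 𝕜 (.node .α a (.node .α b c)) := by
  have := (mk_eq_zero 𝕜).2 (mem_treeIdeal (S := DComSig) (DComRel 𝕜) (.of _ .assoc) ![a, b, c])
  erw [map_sub, map_sub, mk_lmapDomain_bind_dT, mk_lmapDomain_bind_dT] at this
  exact sub_eq_zero.1 this

theorem of_leibniz (a b c : Tree DComOp X) :
    of 𝕜 (.node .d (.node .α a b) c) =
      of 𝕜 (.node .α a (.node .d b c)) + of 𝕜 (.node .α (.node .d a c) b) := by
  have := (mk_eq_zero 𝕜).2 (mem_treeIdeal (S := DComSig) (DComRel 𝕜) (.of _ .leibniz) ![a, b, c])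
  erw [map_sub, map_sub, map_sub, map_sub, mk_lmapDomain_bind_dT, mk_lmapDomain_bind_dT,
    mk_lmapDomain_bind_dT] at this
  rw [sub_sub] at this
  exact sub_eq_zero.1 this

theorem mulLin_comm (a b : DComAlg 𝕜 X) : mulLin 𝕜 a b = mulLin 𝕜 b a := by
  have : mulLin 𝕜 (X := X) = (mulLin 𝕜).flip := hom_ext 𝕜 fun s => hom_ext 𝕜 fun t => by
    rw [LinearMap.flip_apply, mulLin_of, mulLin_of, of_comm]
  exact LinearMap.congr_fun₂ this a b

theorem mulLin_assoc (a b c : DComAlg 𝕜 X) :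
    mulLin 𝕜 (mulLin 𝕜 a b) c = mulLin 𝕜 a (mulLin 𝕜 b c) := by
  -- Associativity is extended from trees to all elements one argument at a time.
  have hc (s t : Tree DComOp X) : mulLin 𝕜 (mulLin 𝕜 (of 𝕜 s) (of 𝕜 t)) =
      mulLin 𝕜 (of 𝕜 s) ∘ₗ mulLin 𝕜 (of 𝕜 t) := hom_ext 𝕜 fun r => by
    simp only [LinearMap.comp_apply, mulLin_of, of_assoc]
  have hb (s : Tree DComOp X) (c : DComAlg 𝕜 X) : (mulLin 𝕜).flip c ∘ₗ mulLin 𝕜 (of 𝕜 s) =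
      mulLin 𝕜 (of 𝕜 s) ∘ₗ (mulLin 𝕜).flip c := hom_ext 𝕜 fun t =>
    LinearMap.congr_fun (hc s t) c
  have ha (b c : DComAlg 𝕜 X) : (mulLin 𝕜).flip c ∘ₗ (mulLin 𝕜).flip b =
      (mulLin 𝕜).flip (mulLin 𝕜 b c) := hom_ext 𝕜 fun s =>
    LinearMap.congr_fun (hb s c) b
  exact LinearMap.congr_fun (ha b c) a

noncomputable instance : NonUnitalCommRing (DComAlg 𝕜 X) where
  mul a b := mulLin 𝕜 a b
  left_distrib a b c := (mulLin 𝕜 a).map_add b c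
  right_distrib a b c := LinearMap.map_add₂ _ a b c
  zero_mul a := LinearMap.map_zero₂ _ a
  mul_zero a := (mulLin 𝕜 a).map_zero
  mul_assoc := mulLin_assoc 𝕜
  mul_comm := mulLin_comm 𝕜

theorem of_mul_of (s t : Tree DComOp X) : of 𝕜 s * of 𝕜 t = of 𝕜 (.node .α s t) := mulLin_of 𝕜 s t

instance : IsScalarTower 𝕜 (DComAlg 𝕜 X) (DComAlg 𝕜 X) :=
  ⟨fun r a b => LinearMap.map_smul₂ (mulLin 𝕜) r a b⟩

instance : SMulCommClass 𝕜 (DComAlg 𝕜 X) (DComAlg 𝕜 X) :=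
  ⟨fun r a b => ((mulLin 𝕜 a).map_smul r b).symm⟩

/-- By bilinearity this reduces to trees, where it is the Leibniz relation with the leaf `v` as
derivation. -/
theorem dLin_mul (v : X) (a b : DComAlg 𝕜 X) :
    dLin 𝕜 v (a * b) = a * dLin 𝕜 v b + dLin 𝕜 v a * b := by
  have : (mulLin 𝕜 (X := X)).compr₂ (dLin 𝕜 v) =
      (mulLin 𝕜).compl₂ (dLin 𝕜 v) + mulLin 𝕜 ∘ₗ dLin 𝕜 v :=
    hom_ext 𝕜 fun s => hom_ext 𝕜 fun t => by
      simp only [LinearMap.compr₂_apply, LinearMap.add_apply, LinearMap.compl₂_apply,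
        LinearMap.comp_apply, dLin_of, mulLin_of, of_leibniz]
  exact LinearMap.congr_fun₂ this a b

end DComAlg

end DComAlgebra

/-! ### Jet polynomials, their evaluation, and the embedding -/

section Embedding

open Colour MvPolynomial

variable (𝕜) {X : Type}

/-- The derivation of the polynomial ring in the derivatives of the elements of `X` which applies the
derivative in the direction `v`. The variable `(a, w)` stands for the iterated derivative of `a`
along the word `w`. -/
noncomputable def dirDeriv (v : X) :
    Derivation 𝕜 (MvPolynomial (X × List X) 𝕜) (MvPolynomial (X × List X) 𝕜) :=
  mkDerivation 𝕜 fun p => MvPolynomial.X (p.1, v :: p.2)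

/-- The assignment of a variable and a derivation to each label. -/
noncomputable def jetPoint (a : X) : MvPolynomial (X × List X) 𝕜 ×
    Derivation 𝕜 (MvPolynomial (X × List X) 𝕜) (MvPolynomial (X × List X) 𝕜) :=
  (MvPolynomial.X (a, []), dirDeriv 𝕜 a)

/-- The iterated derivative of `a` along a word, as a tree. -/
def jetTree (a : X) : List X → Tree DComOp X
  | [] => .leaf a
  | v :: w => .node .d (jetTree a w) (.leaf v)

/-- The algebra morphism from polynomials in the derivatives to the unitization of the algebra of
trees. -/
noncomputable def jetHom :
    MvPolynomial (X × List X) 𝕜 →ₐ[𝕜] Unitization 𝕜 (DComAlg 𝕜 X) :=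
  aeval fun p => (DComAlg.of 𝕜 (jetTree p.1 p.2) : Unitization 𝕜 (DComAlg 𝕜 X))

/-- The extension of the operation `d` by zero on constants. -/
noncomputable def unitDeriv (v : X) :
    Unitization 𝕜 (DComAlg 𝕜 X) →ₗ[𝕜] Unitization 𝕜 (DComAlg 𝕜 X) :=
  Unitization.inrHom 𝕜 𝕜 (DComAlg 𝕜 X) ∘ₗ DComAlg.dLin 𝕜 v ∘ₗ Unitization.sndHom 𝕜 𝕜 (DComAlg 𝕜 X)

theorem unitDeriv_inr (v : X) (a : DComAlg 𝕜 X) :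
    unitDeriv 𝕜 v (a : Unitization 𝕜 (DComAlg 𝕜 X)) = (DComAlg.dLin 𝕜 v a : DComAlg 𝕜 X) := rfl

theorem unitDeriv_algebraMap (v : X) (r : 𝕜) :
    unitDeriv 𝕜 v (algebraMap 𝕜 (Unitization 𝕜 (DComAlg 𝕜 X)) r) = 0 := by
  simp [unitDeriv, Unitization.algebraMap_eq_inl]

/-- Killing the constants is what keeps the Leibniz rule valid on the unitization. The unit is
needed because `DCom` has no operation of arity zero, whereas polynomials have constants. -/
theorem unitDeriv_mul (v : X) (a b : Unitization 𝕜 (DComAlg 𝕜 X)) :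
    unitDeriv 𝕜 v (a * b) = a * unitDeriv 𝕜 v b + b * unitDeriv 𝕜 v a := by
  refine Unitization.ext ?_ ?_
  · simp [unitDeriv]
  · simp [unitDeriv, DComAlg.dLin_mul, mul_comm]
    abel

/-- Both sides satisfy the Leibniz rule along `jetHom` and kill constants, so comparison on
variables is enough. -/
theorem jetHom_dirDeriv (v : X) (p : MvPolynomial (X × List X) 𝕜) :
    jetHom 𝕜 (dirDeriv 𝕜 v p) = unitDeriv 𝕜 v (jetHom 𝕜 p) := by
  induction p using MvPolynomial.induction_on with
  | C r =>
    rw [← algebraMap_eq, Derivation.map_algebraMap, AlgHom.commutes, unitDeriv_algebraMap, map_zero]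
  | add p q hp hq => simp only [map_add, hp, hq]
  | mul_X p x hp =>
    rw [Derivation.leibniz, map_add, smul_eq_mul, smul_eq_mul, map_mul, map_mul, map_mul, hp,
      unitDeriv_mul]
    congr 2
    -- Prepending `v` to the word corresponds to adding a root `d` with right leaf `v` to the jet
    -- tree.
    rw [dirDeriv, mkDerivation_X, jetHom, aeval_X, aeval_X, unitDeriv_inr, DComAlg.dLin_of]
    rfl

/-- The inclusion of the generators of `DCom` into those of `LieR`. -/
def dComToLieR : DComSig.Hom LieRSig where
  op
    | .α => .α
    | .d => .d
  left_op g := by cases g <;> rfl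
  right_op g := by cases g <;> rfl
  out_op g := by cases g <;> rfl

theorem Tree.HasColour.exists_eq_leaf {χ : X → Colour} {t : Tree DComOp X}
    (h : t.HasColour DComSig χ der) : ∃ v, t = .leaf v := by
  cases t with
  | leaf v => exact ⟨v, rfl⟩
  | node g l r => exact absurd h.1 (by simp [DComSig])

/-- Products go to products. At a vertex `d`, the colouring forces the right subtree to be a leaf
`v`, which acts by `dirDeriv 𝕜 v`, and `jetHom_dirDeriv` applies. Thus the polynomial remembers the
tree modulo the relations. -/
theorem jetHom_eval {χ : X → Colour} {t : Tree DComOp X} (h : t.HasColour DComSig χ fn) :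
    jetHom 𝕜 (Tree.eval (derOp 𝕜 _) (jetPoint 𝕜) (t.mapOp dComToLieR.op)).1 =
      (DComAlg.of 𝕜 t : Unitization 𝕜 (DComAlg 𝕜 X)) := by
  induction t with
  | leaf a => exact aeval_X _ _
  | node g l r hl hr =>
    cases g with
    | α =>
      rw [← DComAlg.of_mul_of, Unitization.inr_mul, ← hl h.2.1, ← hr h.2.2, ← map_mul]
      rfl
    | d =>
      obtain ⟨v, rfl⟩ := Tree.HasColour.exists_eq_leaf h.2.2
      rw [← DComAlg.dLin_of, ← unitDeriv_inr, ← hl h.2.1, ← jetHom_dirDeriv]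
      rfl

theorem freeEval_freeMap_single {V : Type w} [AddCommGroup V] [Module 𝕜 V]
    (op : LieROp → V →ₗ[𝕜] V →ₗ[𝕜] V) {A : CSet Colour} {c : Colour} (ρ : A.carrier → V)
    (m : TreeMonomial DComSig A c) (r : 𝕜) :
    freeEval (S := LieRSig) op c ρ ((freeMap dComToLieR).app A c (Finsupp.single m r)) =
      r • Tree.eval op ρ (m.tree.mapOp dComToLieR.op) :=
  (congrArg _ Finsupp.mapDomain_single).trans (freeEval_single (S := LieRSig) op c ρ _ r)

theorem comp_freeEval_freeMap_single {V : Type w} [AddCommGroup V] [Module 𝕜 V] {M : Type w'}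
    [AddCommGroup M] [Module 𝕜 M] (p : V →ₗ[𝕜] M)
    (op : LieROp → V →ₗ[𝕜] V →ₗ[𝕜] V) {A : CSet Colour} {c : Colour} (ρ : A.carrier → V)
    (m : TreeMonomial DComSig A c) (r : 𝕜) :
    (p ∘ₗ freeEval (S := LieRSig) op c ρ ∘ₗ (freeMap dComToLieR).app A c) (Finsupp.single m r) =
      r • p (Tree.eval op ρ (m.tree.mapOp dComToLieR.op)) :=
  (congrArg p (freeEval_freeMap_single 𝕜 op ρ m r)).trans (p.map_smul _ _)

/-- The polynomial obtained by evaluating an operation of the free operad at the universal point. -/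
noncomputable def jetEval (A : CSet Colour) (c : Colour) :
    (free 𝕜 DComSig).obj A c →ₗ[𝕜] MvPolynomial (A.carrier × List A.carrier) 𝕜 :=
  LinearMap.fst 𝕜 (MvPolynomial (A.carrier × List A.carrier) 𝕜) (Derivation 𝕜 _ _) ∘ₗ
    freeEval (S := LieRSig) (derOp 𝕜 _) c (jetPoint 𝕜) ∘ₗ (freeMap dComToLieR).app A c

theorem jetEval_single {A : CSet Colour} {c : Colour} (m : TreeMonomial DComSig A c) (r : 𝕜) :
    jetEval 𝕜 A c (Finsupp.single m r) =
      r • LinearMap.fst 𝕜 (MvPolynomial (A.carrier × List A.carrier) 𝕜) (Derivation 𝕜 _ _)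
        (Tree.eval (derOp 𝕜 _) (jetPoint 𝕜) (m.tree.mapOp dComToLieR.op)) :=
  comp_freeEval_freeMap_single 𝕜 (LinearMap.fst 𝕜
    (MvPolynomial (A.carrier × List A.carrier) 𝕜) (Derivation 𝕜 _ _)) (derOp 𝕜 _) (jetPoint 𝕜) m r

theorem jetEval_eq_zero_of_inIdeal {A : CSet Colour} {c : Colour} {μ : (free 𝕜 DComSig).obj A c}
    (hμ : (free 𝕜 LieRSig).InIdeal (LieRRel 𝕜) A c ((freeMap dComToLieR).app A c μ)) :
    jetEval 𝕜 A c μ = 0 :=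
  congrArg (LinearMap.fst 𝕜 _ _) (freeEval_derOp_eq_zero_of_inIdeal 𝕜
    (MvPolynomial (A.carrier × List A.carrier) 𝕜) hμ (jetPoint 𝕜))

theorem jetHom_jetEval {A : CSet Colour} (μ : TreeMonomial DComSig A fn →₀ 𝕜) :
    jetHom 𝕜 (jetEval 𝕜 A fn μ) =
      (DComAlg.mk 𝕜 (Finsupp.lmapDomain 𝕜 𝕜 TreeMonomial.tree μ) :
        Unitization 𝕜 (DComAlg 𝕜 A.carrier)) := by
  have key : (jetHom 𝕜).toLinearMap ∘ₗ jetEval 𝕜 A fn =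
      Unitization.inrHom 𝕜 𝕜 (DComAlg 𝕜 A.carrier) ∘ₗ DComAlg.mk 𝕜 ∘ₗ
        Finsupp.lmapDomain 𝕜 𝕜 (TreeMonomial.tree (S := DComSig) (A := A) (c := fn)) := by
    refine Finsupp.lhom_ext' fun m => LinearMap.ext_ring ?_
    refine (congrArg (jetHom 𝕜) ((jetEval_single 𝕜 m 1).trans (one_smul _ _))).trans ?_
    refine (jetHom_eval 𝕜 m.hasColour).trans ?_
    refine congrArg (fun x => Unitization.inr (R := 𝕜) (DComAlg.mk 𝕜 x)) ?_
    exact Finsupp.mapDomain_single.symm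
  exact LinearMap.congr_fun key μ

/-- A tree with output `der` is a leaf, so there is at most one monomial. It is still detected by
the function component, since `jetPoint` gives every label a variable, including those of colour
`der`. -/
theorem eq_zero_of_jetEval_eq_zero {A : CSet Colour} {μ : TreeMonomial DComSig A der →₀ 𝕜}
    (h : jetEval 𝕜 A der μ = 0) : μ = 0 := by
  by_contra hz
  obtain ⟨m, hm⟩ := Finsupp.ne_iff.1 hz
  obtain ⟨a, ha⟩ := Tree.HasColour.exists_eq_leaf m.hasColour
  have hsub : ∀ m', m' = m := fun m' => by
    obtain ⟨b, hb⟩ := Tree.HasColour.exists_eq_leaf m'.hasColour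
    have hab := m.mem b
    rw [ha] at hab
    exact TreeMonomial.ext' (hb.trans ((congrArg Tree.leaf (List.mem_singleton.1 hab)).trans ha.symm))
  have hμm : μ = Finsupp.single m (μ m) := by
    ext m'
    rw [hsub m', Finsupp.single_eq_same]
  rw [hμm] at h
  have h1 := (jetEval_single 𝕜 m (μ m)).symm.trans h
  rw [ha] at h1
  exact smul_ne_zero hm (MvPolynomial.X_ne_zero (R := 𝕜) (a, [])) h1

/-- This is injectivity on representatives: a combination of `DCom` trees that is a consequence of
the `LieR` relations is already one of the `DCom` relations. -/
theorem inIdeal_dComRel_of_freeMap {A : CSet Colour} {c : Colour}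
    (μ : TreeMonomial DComSig A c →₀ 𝕜)
    (hμ : (free 𝕜 LieRSig).InIdeal (LieRRel 𝕜) A c ((freeMap dComToLieR).app A c μ)) :
    (free 𝕜 DComSig).InIdeal (DComRel 𝕜) A c μ := by
  have h0 : jetEval 𝕜 A c μ = 0 := jetEval_eq_zero_of_inIdeal 𝕜 hμ
  cases c with
  | fn =>
    have h1 := (jetHom_jetEval 𝕜 μ).symm.trans ((congrArg (jetHom 𝕜) h0).trans (map_zero _))
    -- The algebra of trees embeds in its unitization, so the class vanishes there already; what
    -- remains is to return to the operadic ideal.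
    have h2 := (DComAlg.mk_eq_zero 𝕜).1
      (Unitization.inr_injective (h1.trans (Unitization.inr_zero 𝕜).symm))
    have h3 := multilinearPart_mem_ideal (S := DComSig) (DComRel 𝕜) h2
    rwa [multilinearPart_lmapDomain_tree] at h3
  | der =>
    rw [eq_zero_of_jetEval_eq_zero 𝕜 h0]
    exact Operad.InIdeal.zero (P := free 𝕜 DComSig)

theorem freeMap_dT {n : ℕ} (χ : Fin (n + 1) → Colour) (c : Colour)
    (t : Tree DComOp (Fin (n + 1))) (h : t.HasColour DComSig χ c) (hn : t.leaves.Nodup)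
    (hm : ∀ a, a ∈ t.leaves) :
    (freeMap dComToLieR).app (CSet.ofFin χ) c (dT 𝕜 χ c t h hn hm) =
      lT 𝕜 χ c (t.mapOp dComToLieR.op) (Tree.HasColour.mapOp dComToLieR h)
        ((congrArg List.Nodup (Tree.leaves_mapOp (O := DComOp) dComToLieR.op t)).mpr hn)
        (fun a => (congrArg (a ∈ ·) (Tree.leaves_mapOp (O := DComOp) dComToLieR.op t)).mpr (hm a)) :=
  Finsupp.mapDomain_single

/-- The inclusion of generators sends each `DCom` relation to the `LieR` relation of the same name.
-/
theorem inIdeal_freeMap_of_dComRel {A : CSet Colour} {c : Colour} {μ : (free 𝕜 DComSig).obj A c}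
    (hμ : DComRel 𝕜 A c μ) :
    (free 𝕜 LieRSig).InIdeal (LieRRel 𝕜) A c ((freeMap dComToLieR).app A c μ) := by
  cases hμ
  case comm =>
    erw [map_sub, freeMap_dT, freeMap_dT]
    exact .of _ .comm
  case assoc =>
    erw [map_sub, freeMap_dT, freeMap_dT]
    exact .of _ .assoc
  case leibniz =>
    erw [map_sub, map_sub, freeMap_dT, freeMap_dT, freeMap_dT]
    exact .of _ .leibniz

end Embedding

end ColOp

theorem mainTheorem12 (𝕜 : Type*) [Field 𝕜] [CharZero 𝕜] :
    ∃ F : ColOp.Operad.Hom (ColOp.DCom 𝕜) (ColOp.LieR 𝕜),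
      (F.app _ _ (ColOp.DCom.α 𝕜) = ColOp.LieR.α 𝕜 ∧ F.app _ _ (ColOp.DCom.d 𝕜) = ColOp.LieR.d 𝕜) ∧
      (∀ G : ColOp.Operad.Hom (ColOp.DCom 𝕜) (ColOp.LieR 𝕜),
        G.app _ _ (ColOp.DCom.α 𝕜) = ColOp.LieR.α 𝕜 → G.app _ _ (ColOp.DCom.d 𝕜) = ColOp.LieR.d 𝕜 →
          G = F) ∧
      ∀ (A : ColOp.CSet ColOp.Colour) (c : ColOp.Colour), Function.Injective (F.app A c) := by
  let F : ColOp.Operad.Hom (ColOp.DCom 𝕜) (ColOp.LieR 𝕜) :=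
    ColOp.Operad.quotientMap (ColOp.freeMap ColOp.dComToLieR)
      fun _ _ _ hμ => ColOp.inIdeal_freeMap_of_dComRel 𝕜 hμ
  have hα : F.app _ _ (ColOp.DCom.α 𝕜) = ColOp.LieR.α 𝕜 :=
    congrArg (Submodule.mkQ _) (ColOp.freeMap_dT 𝕜 _ _ _ _ _ _)
  have hd : F.app _ _ (ColOp.DCom.d 𝕜) = ColOp.LieR.d 𝕜 :=
    congrArg (Submodule.mkQ _) (ColOp.freeMap_dT 𝕜 _ _ _ _ _ _)
  refine ⟨F, ⟨hα, hd⟩, fun G hGα hGd => ?_, fun A c => ?_⟩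
  -- The corollas of `α` and `d` are the only generators, and their values are prescribed.
  · refine ColOp.Operad.Hom.quotient_ext (ColOp.Operad.Hom.free_ext fun g => ?_)
    cases g with
    | α => exact hGα.trans hα.symm
    | d => exact hGd.trans hd.symm
  · refine (injective_iff_map_eq_zero (F.app A c)).2 fun μ hμ => ?_
    obtain ⟨μ, rfl⟩ := Submodule.mkQ_surjective _ μ
    exact (Submodule.Quotient.mk_eq_zero _).2 (ColOp.inIdeal_dComRel_of_freeMap 𝕜 μ
      ((Submodule.Quotient.mk_eq_zero _).1 hμ))
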